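/- Let $(W,S)$ be any Coxeter system ($S$ possibly infinite), let $m_{st}\in\mathbf{Z}_{\ge 1}\cup\{\infty\}$ be the order of $st$ for $s,t\in S$, let $\ell$ be the length function, and let $\mathcal{R}$ be the set of reflections of $W$, that is, the set of all conjugates in $W$ of elements of $S$. A reflection subgroup of $W$ is a subgroup generated by a subset of $\mathcal{R}$. Let $\mathbf{k}$ be a commutative ring with $1$, and let $\underline{u}=(u_s)_{s\in S}$ be elements of $\mathbf{k}$ such that $u_s=u_t$ whenever $s,t\in S$ are conjugate in $W$. Let $\mathcal{C}_W(\underline{u})$ be the associative unital $\mathbf{k}$-algebra with generators $g_s$ ($s\in S$) and $e_t$ ($t\in\mathcal{R}$) and relations 1. $\underbrace{g_sg_tg_s\cdots}_{m_{st}}=\underbrace{g_tg_sg_t\cdots}_{m_{st}}$ for $s,t\in S$ with $m_{st}<\infty$; 2. $e_t^2=e_t$ for $t\in\mathcal{R}$; 3. $e_{t_1}e_{t_2}=e_{t_2}e_{t_1}$ for $t_1,t_2\in\mathcal{R}$; 4. $e_te_{t_1}=e_te_{tt_1t^{-1}}$ for $t,t_1\in\mathcal{R}$; 5. $g_se_t=e_{sts}g_s$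 for $s\in S$, $t\in\mathcal{R}$; 6. $g_s^2=1+(u_s-1)e_s(1+g_s)$ for $s\in S$. For $w\in W$ put $g_w=g_{s_1}\cdots g_{s_r}$, where $s_1\cdots s_r$ is any reduced expression of $w$ (by the braid relations this does not depend on the expression), and for a finite subset $J\subset\mathcal{R}$ put $e_J=\prod_{t\in J}e_t$. For every finitely generated reflection subgroup $W_0$ of $W$ choose a finite set $\overline{J}(W_0)\subset\mathcal{R}$ generating $W_0$. **Theorem.** The algebra $\mathcal{C}_W(\underline{u})$ is a free $\mathbf{k}$-module and, for every such choice of representatives, the elements $e_{\overline{J}(W_0)}\,g_w$, indexed by the pairs $(W_0,w)$ with $W_0$ a finitely generated reflection subgroup of $W$ and $w\in W$, form a basis of it. In particular, if $W$ is finite, then $\mathcal{C}_W(\underline{u})$ is a finitely generated $\mathbf{k}$-module and (if $\mathbf{k}\neq 0$, so that the rank is well defined) its rank is $|W|$ multiplied by the number of reflection subgroups of $W$. -/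

import Mathlib

namespace CoxeterSystem

variable {B : Type*} {W : Type*} [Group W] {M : CoxeterMatrix B} (cs : CoxeterSystem M W)

/-- The type of reflections of `(W, S)`: the conjugates in `W` of the elements of `S`. -/
abbrev Refl : Type _ := {t : W // cs.IsReflection t}

/-- An element of `S`, as a reflection. -/
def simpleRefl (i : B) : cs.Refl := ⟨cs.simple i, cs.isReflection_simple i⟩

/-- The reflection `w t w⁻¹`. -/
def conjRefl (w : W) (t : cs.Refl) : cs.Refl := ⟨w * t.1 * w⁻¹, t.2.conj w⟩

/-- The subgroup `⟨J⟩` of `W` generated by a set `J` of reflections. -/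
def reflClosure (J : Set cs.Refl) : Subgroup W := Subgroup.closure (Subtype.val '' J)

/-- A reflection subgroup of `W` is a subgroup generated by a set of reflections. -/
def IsReflectionSubgroup (H : Subgroup W) : Prop := ∃ J : Set cs.Refl, cs.reflClosure J = H

/-- The finitely generated reflection subgroups of `W`. -/
abbrev FGReflectionSubgroup : Type _ := {H : Subgroup W // cs.IsReflectionSubgroup H ∧ H.FG}

section Algebra

variable {k : Type*} [CommRing k]

/-- The free generator `g_s` (before imposing relations). -/
def freeG (i : B) : FreeAlgebra k (B ⊕ cs.Refl) := FreeAlgebra.ι k (Sum.inl i)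

/-- The free generator `e_t` (before imposing relations). -/
def freeE (t : cs.Refl) : FreeAlgebra k (B ⊕ cs.Refl) := FreeAlgebra.ι k (Sum.inr t)

/-- The defining relations of the algebra. An infinite order is encoded as `M i j = 0`; the
braid relation for such a pair reads `1 = 1`. -/
inductive AlgRel (u : B → k) :
    FreeAlgebra k (B ⊕ cs.Refl) → FreeAlgebra k (B ⊕ cs.Refl) → Prop
  | braid (i j : B) :
      AlgRel u ((braidWord M i j).map cs.freeG).prod ((braidWord M j i).map cs.freeG).prod
  | e_idem (t : cs.Refl) : AlgRel u (cs.freeE t * cs.freeE t) (cs.freeE t)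
  | e_comm (t₁ t₂ : cs.Refl) :
      AlgRel u (cs.freeE t₁ * cs.freeE t₂) (cs.freeE t₂ * cs.freeE t₁)
  | e_conj (t t₁ : cs.Refl) :
      AlgRel u (cs.freeE t * cs.freeE t₁) (cs.freeE t * cs.freeE (cs.conjRefl t.1 t₁))
  | g_e (i : B) (t : cs.Refl) :
      AlgRel u (cs.freeG i * cs.freeE t) (cs.freeE (cs.conjRefl (cs.simple i) t) * cs.freeG i)
  | g_sq (i : B) :
      AlgRel u (cs.freeG i * cs.freeG i)
        (1 + algebraMap k _ (u i - 1) * cs.freeE (cs.simpleRefl i) * (1 + cs.freeG i))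

/-- The `k`-algebra `C_W(u)` with generators `g_s` (`s ∈ S`), `e_t` (`t` a reflection) and the
relations above. -/
abbrev CAlg (u : B → k) : Type _ := RingQuot (cs.AlgRel u)

variable (u : B → k)

/-- The generator `g_s` of `C_W(u)`. -/
def g (i : B) : cs.CAlg u := RingQuot.mkAlgHom k (cs.AlgRel u) (cs.freeG i)

/-- The generator `e_t` of `C_W(u)`. -/
def e (t : cs.Refl) : cs.CAlg u := RingQuot.mkAlgHom k (cs.AlgRel u) (cs.freeE t)

/-- The product `g_{s₁} ⋯ g_{sᵣ}` for a word `s₁ ⋯ sᵣ` in `S`. For a reduced word with product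
`w` this is `g_w`. -/
def gWord (ω : List B) : cs.CAlg u := (ω.map (cs.g u)).prod

theorem e_commute (t₁ t₂ : cs.Refl) : Commute (cs.e u t₁) (cs.e u t₂) := by
  have h := RingQuot.mkAlgHom_rel k (AlgRel.e_comm (cs := cs) (u := u) t₁ t₂)
  simpa [Commute, SemiconjBy, e] using h

/-- The product `e_J = ∏_{t ∈ J} e_t` of the commuting elements `e_t`, for a finite set `J` of
reflections. -/
def eProd (J : Finset cs.Refl) : cs.CAlg u :=
  J.noncommProd (cs.e u) fun t₁ _ t₂ _ _ => cs.e_commute u t₁ t₂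

end Algebra

end CoxeterSystem

/-! The algebra is identified with the free module `V` on the pairs `(H, w)` by making it act on `V`
as on its own left regular module. The formulas are forced: `e_K` joins `K` to `H`, and `g_s` sends
`e_H g_w` to `e_{sHs} g_s g_w`, where `g_s g_w` is `g_{sw}` plus, at a descent, a term coming from
the quadratic relation.

Two points are hard. The first is that `e_J` depends only on `⟨J⟩` (`eProd_eq_of_fgClosure_eq`). The
reflections `t` with `e_J e_t = e_J` are stable under conjugation by one another, and such a set
contains every reflection of the subgroup it generates (`mem_of_isReflection_of_mem_closure`).

The second is the braid relation for the operators `opG` (`opG_braid`). They commute with right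
multiplications `opR`; by `eq_of_commute_opR`, both sides of the relation are then determined by
their value at `(⊥, 1)`. There they agree because braid words are reduced, which needs the exact
order of `st` (`orderOf_simple_mul_simple`).

Finally `(H, w) ↦ e_H g_w` is a morphism of left modules sending `(⊥, 1)` to `1`, and `c ↦ c · (⊥,
1)` is its two-sided inverse. -/

namespace CoxeterSystem

variable {B : Type*} {W : Type*} [Group W] {M : CoxeterMatrix B} (cs : CoxeterSystem M W)

/-! ### The inversion cocycle and the exchange property. -/

section Inversions

open Classical in
/-- The involution of `W × ℤ/2` sending `(t, ε)` to `(s t s, ε + [t = s])`. -/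
noncomputable def invPerm (i : B) : Equiv.Perm (W × ZMod 2) :=
  Function.Involutive.toPerm
    (fun p => (cs.simple i * p.1 * cs.simple i, p.2 + if p.1 = cs.simple i then 1 else 0)) <| by
    rintro ⟨t, ε⟩
    have h : t * cs.simple i = 1 ↔ t = cs.simple i := by
      rw [← cs.simple_mul_simple_self i, mul_left_inj]
    by_cases ht : t = cs.simple i
    · simp [ht, add_assoc, CharTwo.add_self_eq_zero]
    · simp [h, ht, mul_assoc]

open Classical in
theorem invPerm_apply (i : B) (p : W × ZMod 2) : cs.invPerm i p =
    (cs.simple i * p.1 * cs.simple i, p.2 + if p.1 = cs.simple i then 1 else 0) := rfl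

theorem invPerm_mul_self (i : B) : cs.invPerm i * cs.invPerm i = 1 :=
  Equiv.ext fun p => (cs.invPerm i).left_inv p

-- The sign coordinate records, modulo 2, how often `t` occurs in the left inversion sequence.
-- Reversing the word makes the product act as the inverse of `wordProd ω`.
open Classical in
theorem prod_map_invPerm_reverse_apply (ω : List B) (t : W) (ε : ZMod 2) :
    (ω.reverse.map cs.invPerm).prod (t, ε) =
      ((cs.wordProd ω)⁻¹ * t * cs.wordProd ω, ε + ((cs.leftInvSeq ω).count t : ℕ)) := by
  induction ω generalizing t ε with
  | nil => simp
  | cons i ω ih =>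
    have hinj : Function.Injective (MulAut.conj (cs.simple i)) := (MulAut.conj _).injective
    have h : ((cs.leftInvSeq ω).map (MulAut.conj (cs.simple i))).count t =
        (cs.leftInvSeq ω).count (cs.simple i * t * cs.simple i) := by
      rw [← List.count_map_of_injective (cs.leftInvSeq ω) _ hinj]
      congr 1
      simp [mul_assoc]
    simp only [List.reverse_cons, List.map_append, List.map_cons, List.map_nil, List.prod_append,
      List.prod_cons, List.prod_nil, mul_one, Equiv.Perm.mul_apply, invPerm_apply, ih,
      leftInvSeq, List.count_cons, h, wordProd_cons, mul_inv_rev, inv_simple]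
    by_cases ht : t = cs.simple i
    · simp [ht, mul_assoc]
      ring
    · simp [ht, Ne.symm ht, mul_assoc]

-- Since `(s_i s_j) ^ M i j = 1`, the inversion sequence is periodic of period `M i j`: its second
-- half repeats the first.
open Classical in
theorem even_count_leftInvSeq_alternatingWord (i j : B) (t : W) :
    Even ((cs.leftInvSeq (alternatingWord i j (2 * M i j))).count t) := by
  set l := cs.leftInvSeq (alternatingWord i j (2 * M i j)) with hl
  have hlen : l.length = 2 * M i j := by simp [hl]
  have h : l.drop (M i j) = l.take (M i j) := by
    apply List.ext_getElem
    · simp [hlen]; omega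
    intro n h₁ h₂
    have hn : n < M i j := by simp [hlen] at h₂; omega
    rw [List.getElem_drop, List.getElem_take]
    simp only [hl]
    rw [getElem_leftInvSeq_alternatingWord cs i j _ _ (by omega),
      getElem_leftInvSeq_alternatingWord cs i j _ _ (by omega)]
    rw [prod_alternatingWord_eq_mul_pow, prod_alternatingWord_eq_mul_pow]
    have h₁ : ¬ Even (2 * (M i j + n) + 1) := by simp [parity_simps]
    have h₂ : ¬ Even (2 * n + 1) := by simp [parity_simps]
    rw [if_neg h₁, if_neg h₂, show (2 * (M i j + n) + 1) / 2 = M i j + n by omega,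
      show (2 * n + 1) / 2 = n by omega, pow_add]
    simp
  rw [← List.take_append_drop (M i j) l, List.count_append, h]
  exact ⟨_, rfl⟩

theorem isLiftable_invPerm : M.IsLiftable cs.invPerm := by
  intro i j
  classical
  have h : (cs.invPerm j * cs.invPerm i) ^ M i j = 1 := by
    have hrev : ((alternatingWord i j (2 * M i j)).reverse.map cs.invPerm).prod =
        (cs.invPerm j * cs.invPerm i) ^ M i j := by
      induction M i j with
      | zero => simp [alternatingWord]
      | succ n ih =>
        rw [pow_succ', ← ih, show 2 * (n + 1) = 2 * n + 1 + 1 by ring, alternatingWord_succ,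
          alternatingWord_succ]
        simp [mul_assoc]
    rw [← hrev]
    ext1 ⟨t, ε⟩
    rw [prod_map_invPerm_reverse_apply, (ZMod.natCast_eq_zero_iff_even).2
      (cs.even_count_leftInvSeq_alternatingWord i j t), prod_alternatingWord_eq_mul_pow]
    simp
  -- The computation gave the relation for the factors in the opposite order; the factors are
  -- involutions, so inverting restores the order.
  have h' := congrArg (fun x => x⁻¹) h
  simp only [← inv_pow, mul_inv_rev, inv_one] at h'
  rwa [inv_eq_of_mul_eq_one_left (cs.invPerm_mul_self i),
    inv_eq_of_mul_eq_one_left (cs.invPerm_mul_self j)] at h'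

/-- The inversion cocycle: `cs.eta w t = 1` when the reflection `t` is a left inversion of `w`,
and `cs.eta w t = 0` when it is not. -/
noncomputable def eta (w t : W) : ZMod 2 :=
  (cs.lift ⟨cs.invPerm, cs.isLiftable_invPerm⟩ w⁻¹ (t, 0)).2

open Classical in
theorem lift_invPerm_wordProd_inv (ω : List B) (t : W) (ε : ZMod 2) :
    cs.lift ⟨cs.invPerm, cs.isLiftable_invPerm⟩ (cs.wordProd ω)⁻¹ (t, ε) =
      ((cs.wordProd ω)⁻¹ * t * cs.wordProd ω, ε + ((cs.leftInvSeq ω).count t : ℕ)) := by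
  rw [← prod_map_invPerm_reverse_apply, ← wordProd_reverse, wordProd, map_list_prod, List.map_map]
  congr 3
  ext1 i
  exact cs.lift_apply_simple cs.isLiftable_invPerm i

open Classical in
theorem eta_wordProd (ω : List B) (t : W) :
    cs.eta (cs.wordProd ω) t = ((cs.leftInvSeq ω).count t : ℕ) := by
  rw [eta, lift_invPerm_wordProd_inv, zero_add]

theorem lift_invPerm_inv (w t : W) (ε : ZMod 2) :
    cs.lift ⟨cs.invPerm, cs.isLiftable_invPerm⟩ w⁻¹ (t, ε) =
      (w⁻¹ * t * w, ε + cs.eta w t) := by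
  classical
  obtain ⟨ω, rfl⟩ := cs.wordProd_surjective w
  rw [lift_invPerm_wordProd_inv, eta_wordProd]

theorem eta_mul (x y t : W) : cs.eta (x * y) t = cs.eta x t + cs.eta y (x⁻¹ * t * x) := by
  have h := cs.lift_invPerm_inv (x * y) t 0
  rw [mul_inv_rev, map_mul, Equiv.Perm.mul_apply, lift_invPerm_inv, lift_invPerm_inv] at h
  simpa using (congrArg Prod.snd h).symm

theorem eta_one (t : W) : cs.eta 1 t = 0 := by
  have h := cs.eta_mul 1 1 t
  simpa using h

theorem eta_simple_self (i : B) : cs.eta (cs.simple i) (cs.simple i) = 1 := by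
  classical
  rw [← wordProd_singleton, eta_wordProd]; simp

theorem eta_simple_eq_one_iff (i : B) (t : W) :
    cs.eta (cs.simple i) t = 1 ↔ t = cs.simple i := by
  classical
  rw [← wordProd_singleton, eta_wordProd]
  by_cases h : t = cs.simple i
  · simp [h]
  · simp [h, Ne.symm h]

theorem eta_eq_zero_or_one (w t : W) : cs.eta w t = 0 ∨ cs.eta w t = 1 := by
  generalize cs.eta w t = a
  revert a; decide

theorem eta_ne_one_iff (w t : W) : cs.eta w t ≠ 1 ↔ cs.eta w t = 0 := by
  generalize cs.eta w t = a
  revert a; decide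

theorem eta_simple_eq_zero {i : B} {t : W} (h : t ≠ cs.simple i) : cs.eta (cs.simple i) t = 0 :=
  (cs.eta_ne_one_iff _ _).1 (mt (cs.eta_simple_eq_one_iff i t).1 h)

theorem mem_leftInvSeq_of_eta {ω : List B} {t : W} (h : cs.eta (cs.wordProd ω) t = 1) :
    t ∈ cs.leftInvSeq ω := by
  classical
  rw [eta_wordProd] at h
  by_contra hc
  rw [List.count_eq_zero_of_not_mem hc] at h
  simp at h

-- Expanding `w s w⁻¹` by the cocycle rule, the contributions of `w` and `w⁻¹` cancel because `eta 1
-- = 0`; the middle factor contributes 1.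
variable {cs} in
theorem IsReflection.eta_self {t : W} (ht : cs.IsReflection t) : cs.eta t t = 1 := by
  obtain ⟨w, i, rfl⟩ := ht
  have h := cs.eta_mul w w⁻¹ (w * cs.simple i * w⁻¹)
  rw [mul_inv_cancel, eta_one] at h
  rw [eta_mul, eta_mul]
  simp only [mul_assoc, inv_mul_cancel, mul_one, inv_mul_cancel_left, mul_inv_rev, inv_simple,
    simple_mul_simple_self] at h ⊢
  rw [eta_simple_self]
  linear_combination -h

-- An inversion occurs in the inversion sequence of a reduced word, hence shortens `w`. The converse
-- applies this to `t * w`, because `eta w t` and `eta (t * w) t` differ by 1.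
variable {cs} in
theorem IsReflection.eta_eq_one_iff {t : W} (ht : cs.IsReflection t) (w : W) :
    cs.eta w t = 1 ↔ cs.length (t * w) < cs.length w := by
  have key : ∀ w, cs.eta w t = 1 → cs.length (t * w) < cs.length w := by
    intro w h
    obtain ⟨ω, hω, rfl⟩ := cs.exists_isReduced w
    exact (cs.isLeftInversion_of_mem_leftInvSeq hω (cs.mem_leftInvSeq_of_eta h)).2
  refine ⟨key w, fun h => ?_⟩
  by_contra hc
  have h' := key (t * w) (by
    rw [eta_mul, ht.eta_self, ht.inv, ht.mul_self, one_mul, (cs.eta_ne_one_iff _ _).1 hc, add_zero])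
  rw [← mul_assoc, ht.mul_self, one_mul] at h'
  omega

theorem eta_simple_right_eq_one_iff (i : B) (w : W) :
    cs.eta w (cs.simple i) = 1 ↔ cs.IsLeftDescent w i :=
  (cs.isReflection_simple i).eta_eq_one_iff w

/-- Left multiplication by `s` and right multiplication by `s'` change lengths independently,
unless `s w = w s'`. -/
theorem isLeftDescent_mul_simple_iff {w : W} {i j : B}
    (h : cs.simple i * w ≠ w * cs.simple j) :
    cs.IsLeftDescent (w * cs.simple j) i ↔ cs.IsLeftDescent w i := by
  rw [← eta_simple_right_eq_one_iff, ← eta_simple_right_eq_one_iff, eta_mul,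
    cs.eta_simple_eq_zero, add_zero]
  intro h'
  apply h
  rw [← h']
  group

theorem isRightDescent_simple_mul_iff {w : W} {i j : B}
    (h : cs.simple i * w ≠ w * cs.simple j) :
    cs.IsRightDescent (cs.simple i * w) j ↔ cs.IsRightDescent w j := by
  rw [← isLeftDescent_inv_iff, ← isLeftDescent_inv_iff (w := w), mul_inv_rev, inv_simple]
  apply isLeftDescent_mul_simple_iff
  intro h'
  apply h
  have := congrArg (fun x => x⁻¹) h'
  simpa using this.symm

end Inversions

/-! ### The geometric representation and the order of `s_i s_j`. -/

section GeometricRepresentation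

open Polynomial.Chebyshev Module Real

/-- The linear form `v ↦ 2 B(α_i, v)` of the geometric representation. -/
noncomputable def _root_.CoxeterMatrix.coroot (M : CoxeterMatrix B) (i : B) :
    Dual ℝ (B →₀ ℝ) :=
  Finsupp.linearCombination ℝ fun j => -2 * cos (π / M i j)

/-- For `M i j = 0`, the convention `π / 0 = 0` gives the value `-2`, as required for infinite
order. -/
theorem _root_.CoxeterMatrix.coroot_single (M : CoxeterMatrix B) (i j : B) :
    M.coroot i (Finsupp.single j 1) = -2 * cos (π / M i j) := by
  simp [CoxeterMatrix.coroot]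

theorem _root_.CoxeterMatrix.coroot_single_self (M : CoxeterMatrix B) (i : B) :
    M.coroot i (Finsupp.single i 1) = 2 := by
  simp [CoxeterMatrix.coroot_single]

/-- The simple reflection of the geometric representation. -/
noncomputable def _root_.CoxeterMatrix.geomReflection (M : CoxeterMatrix B) (i : B) :
    (B →₀ ℝ) ≃ₗ[ℝ] (B →₀ ℝ) :=
  reflection (M.coroot_single_self i)

theorem _root_.CoxeterMatrix.coroot_mul_coroot (M : CoxeterMatrix B) (i j : B) :
    2 * cos (2 * (π / M i j)) =
      M.coroot i (Finsupp.single j 1) * M.coroot j (Finsupp.single i 1) - 2 := by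
  rw [M.coroot_single, M.coroot_single, M.symmetric j i, cos_two_mul]
  ring

theorem sin_two_pi_div_ne_zero {m : ℕ} (hm : 3 ≤ m) : sin (2 * (π / m)) ≠ 0 := by
  have hm' : (3 : ℝ) ≤ m := by exact_mod_cast hm
  have hpos : 0 < π / m := by positivity
  refine (sin_pos_of_pos_of_lt_pi (by linarith) ?_).ne'
  rw [← mul_div_assoc, div_lt_iff₀ (by linarith)]
  nlinarith [pi_pos]

/-- Powers of a product of two reflections have Chebyshev coefficients, and `S_n(2 cos θ) sin θ =
sin((n + 1)θ)`. With `θ = 2π/m`, the coefficients vanish because `kθ = π` for `m = 2k`, and because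
`(k + 1)θ = 2π - kθ` for `m = 2k + 1`. The case `m = 2` is separate since then `sin θ = 0`. -/
theorem _root_.CoxeterMatrix.isLiftable_geomReflection (M : CoxeterMatrix B) :
    M.IsLiftable M.geomReflection := by
  intro i j
  by_cases hij : i = j
  · subst hij
    rw [M.diagonal, pow_one, CoxeterMatrix.geomReflection]
    ext1 v
    exact (involutive_reflection (M.coroot_single_self i)) v
  have h1 := M.off_diagonal i j hij
  ext1 v
  rw [CoxeterMatrix.geomReflection, CoxeterMatrix.geomReflection,
    reflection_mul_reflection_pow_apply _ _ _ _ _ (M.coroot_mul_coroot i j)]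
  have hsin := sin_two_pi_div_ne_zero (m := M i j)
  have hj := M.coroot_single i j
  have hi := M.coroot_single j i
  rw [M.symmetric j i] at hi
  have hS := S_two_mul_real_cos (2 * (π / M i j))
  generalize M i j = m at *
  obtain rfl | rfl | hm : m = 0 ∨ m = 2 ∨ 3 ≤ m := by omega
  · simp
  · norm_num at hi hj
    rw [hi, hj]
    norm_num [show (2 * (π / 2)) = π by ring]
    abel
  have hm0 : (m : ℝ) ≠ 0 := by positivity
  have hsin := hsin hm
  set θ := 2 * (π / m) with hθ
  have hmθ : m * θ = 2 * π := by rw [hθ]; field_simp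
  obtain ⟨k, hk | hk⟩ := Nat.even_or_odd' m
  · have e1 : ((m : ℤ) - 2) / 2 = k - 1 := by omega
    have e2 : ((m : ℤ) - 1) / 2 = k - 1 := by omega
    have hz : (S ℝ (k - 1)).eval (2 * cos θ) = 0 := by
      have h := hS (k - 1)
      have hkθ : k * θ = π := by rw [hk] at hmθ; push_cast at hmθ; linarith
      push_cast at h
      rw [sub_add_cancel, hkθ, sin_pi] at h
      exact (mul_eq_zero.1 h).resolve_right hsin
    rw [e1, e2, hz]
    simp
  · have e1 : ((m : ℤ) - 2) / 2 = k - 1 := by omega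
    have e2 : ((m : ℤ) - 1) / 2 = k := by omega
    have e3 : ((m : ℤ) - 3) / 2 = k - 1 := by omega
    have e4 : (m : ℤ) / 2 = k := by omega
    have hz : (S ℝ k).eval (2 * cos θ) + (S ℝ (k - 1)).eval (2 * cos θ) = 0 := by
      have h := hS k
      have h' := hS (k - 1)
      have hkθ : (k + 1) * θ = 2 * π - k * θ := by rw [hk] at hmθ; push_cast at hmθ; linarith
      push_cast at h h'
      rw [hkθ, sin_two_pi_sub] at h
      rw [sub_add_cancel] at h'
      have : ((S ℝ k).eval (2 * cos θ) + (S ℝ (k - 1)).eval (2 * cos θ)) * sin θ = 0 := by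
        linarith
      exact (mul_eq_zero.1 this).resolve_right hsin
    rw [e1, e2, e3, e4, hz]
    simp

/-- Look at the image of the basis vector at `i`. For `m ≥ 3` and `θ = 2π/m`, its two coordinates
would force `sin(nθ) = 0` and `cos(nθ) = 1` with `0 < nθ < 2π`. For `m = 0` the coordinate at `j` is
a nonzero multiple of `n`. -/
theorem _root_.CoxeterMatrix.geomReflection_pow_ne_one (M : CoxeterMatrix B) {i j : B}
    (hij : i ≠ j) {n : ℕ} (hn : n ≠ 0) (hnm : M i j = 0 ∨ n < M i j) :
    (M.geomReflection i * M.geomReflection j) ^ n ≠ 1 := by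
  intro h
  have h := congrArg (fun f : (B →₀ ℝ) ≃ₗ[ℝ] (B →₀ ℝ) => f (Finsupp.single i 1)) h
  simp only [LinearEquiv.coe_one, id_eq] at h
  rw [CoxeterMatrix.geomReflection, CoxeterMatrix.geomReflection,
    reflection_mul_reflection_pow_apply_self _ _ _ _ (M.coroot_mul_coroot i j)] at h
  have h1 := M.off_diagonal i j hij
  have hi := congrArg (fun v => v i) h
  have hj := congrArg (fun v => v j) h
  simp [hij, Ne.symm hij, M.coroot_single, M.symmetric j i] at hi hj
  have hsin := sin_two_pi_div_ne_zero (m := M i j)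
  have hS := S_two_mul_real_cos (2 * (π / M i j))
  generalize M i j = m at *
  obtain rfl | rfl | hm : m = 0 ∨ m = 2 ∨ 3 ≤ m := by omega
  · simp [hn] at hj
  · obtain rfl : n = 1 := by omega
    norm_num [show (2 * (π / 2)) = π by ring] at hi
  have hm0 : (m : ℝ) ≠ 0 := by positivity
  have hm3 : (3 : ℝ) ≤ m := by exact_mod_cast hm
  have hsin := hsin hm
  have hcos : cos (π / m) ≠ 0 := by
    intro hc
    rw [sin_two_mul, hc] at hsin
    simp at hsin
  have hz := hj.resolve_right hcos
  set θ := 2 * (π / m) with hθ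
  rw [hz, add_zero] at hi
  have h₁ := hS n
  have h₂ := hS (n - 1)
  rw [hz] at h₂
  rw [hi] at h₁
  push_cast at h₁ h₂
  rw [sub_add_cancel, zero_mul] at h₂
  rw [add_one_mul, sin_add, ← h₂, zero_mul, zero_add] at h₁
  have hc : cos (n * θ) = 1 := (mul_right_cancel₀ hsin h₁).symm
  have hnm : (n : ℝ) < m := by
    rcases hnm with h | h
    · omega
    · exact_mod_cast h
  have hn0 : (0 : ℝ) < n := by positivity
  have hmp : (0 : ℝ) < m := by positivity
  have hlt : n * θ < 2 * π := by
    rw [hθ, show n * (2 * (π / m)) = (n / m) * (2 * π) by ring]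
    have : (n : ℝ) / m < 1 := (div_lt_one hmp).2 hnm
    nlinarith [pi_pos]
  have hgt : 0 < n * θ := by positivity
  exact hgt.ne' ((cos_eq_one_iff_of_lt_of_lt (by linarith [pi_pos]) hlt).1 hc)

/-- The order of `s_i s_j` in `W` is `M i j` (infinite if `M i j = 0`). -/
theorem orderOf_simple_mul_simple (i j : B) : orderOf (cs.simple i * cs.simple j) = M i j := by
  by_cases hij : i = j
  · simp [hij]
  have hne : ∀ n, n ≠ 0 → (M i j = 0 ∨ n < M i j) → (cs.simple i * cs.simple j) ^ n ≠ 1 := by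
    intro n hn hnm h
    apply M.geomReflection_pow_ne_one hij hn hnm
    have h' := congrArg (cs.lift ⟨_, M.isLiftable_geomReflection⟩) h
    simpa [cs.lift_apply_simple M.isLiftable_geomReflection] using h'
  have hdvd := orderOf_dvd_of_pow_eq_one (cs.simple_mul_simple_pow i j)
  by_cases h0 : M i j = 0
  · rw [h0, orderOf_eq_zero_iff']
    exact fun n hn => hne n hn.ne' (Or.inl h0)
  · by_contra hc
    exact hne _ (fun h => h0 (Nat.eq_zero_of_zero_dvd (h ▸ hdvd)))
      (Or.inr (lt_of_le_of_ne (Nat.le_of_dvd (Nat.pos_of_ne_zero h0) hdvd) hc))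
      (pow_orderOf_eq_one _)

end GeometricRepresentation

/-! ### Reflections contained in a reflection subgroup. -/

section ReflectionSubgroups

/-- The canonical generators attached to a set `X` of reflections: the elements of `X` whose only
inversion in `X` is themselves. -/
def canonGens (X : Set W) : Set W := {r ∈ X | ∀ t ∈ X, cs.eta r t = 1 → t = r}

/-- By the cocycle rule the two sides differ by values of `eta s` at conjugates of elements of `X`;
each is nonzero only if `s` itself lies in `X`. -/
theorem eta_simple_conj {X : Set W} (hc : ∀ r ∈ X, ∀ t ∈ X, r * t * r⁻¹ ∈ X)
    (hX : ∀ t ∈ X, cs.IsReflection t) {i : B} (hi : cs.simple i ∉ X) {r t : W} (hr : r ∈ X)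
    (ht : t ∈ X) :
    cs.eta (cs.simple i * r * cs.simple i) (cs.simple i * t * cs.simple i) = cs.eta r t := by
  rw [mul_assoc, eta_mul, eta_mul, cs.eta_simple_eq_zero, zero_add, add_eq_left.2]
  · simp [mul_assoc]
  · apply cs.eta_simple_eq_zero
    intro h
    apply hi
    rw [← h]
    have := hc r hr t ht
    simpa [mul_assoc, (hX r hr).inv] using this
  · rw [ne_eq, mul_eq_right, ← cs.simple_mul_simple_self i, mul_right_inj]
    rintro rfl
    exact hi ht

/-- The conjugate of a set of group elements by a simple reflection. -/
def simpleConj (i : B) (X : Set W) : Set W := {t | cs.simple i * t * cs.simple i ∈ X}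

theorem conj_mem_simpleConj {i : B} {X : Set W} (hc : ∀ r ∈ X, ∀ t ∈ X, r * t * r⁻¹ ∈ X) :
    ∀ r ∈ cs.simpleConj i X, ∀ t ∈ cs.simpleConj i X, r * t * r⁻¹ ∈ cs.simpleConj i X := by
  intro r hr t ht
  have := hc _ hr _ ht
  simpa [simpleConj, mul_assoc] using this

theorem isReflection_of_mem_simpleConj {i : B} {X : Set W} (hX : ∀ t ∈ X, cs.IsReflection t) :
    ∀ t ∈ cs.simpleConj i X, cs.IsReflection t := by
  intro t ht
  have := (hX _ ht).conj (cs.simple i)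
  simpa [mul_assoc] using this

theorem simple_mul_mul_simple_mem_closure {i : B} {X Y : Set W}
    (h : ∀ t ∈ Y, cs.simple i * t * cs.simple i ∈ X) {w : W} (hw : w ∈ Subgroup.closure Y) :
    cs.simple i * w * cs.simple i ∈ Subgroup.closure X := by
  induction hw using Subgroup.closure_induction with
  | mem x hx => exact Subgroup.subset_closure (h x hx)
  | one => simp
  | mul x y _ _ hx hy =>
    have := mul_mem hx hy
    simpa [mul_assoc] using this
  | inv x _ hx =>
    have := inv_mem hx
    simpa [mul_assoc] using this

/-- Peel off the first letter `s` of the conjugating word. If `s ∈ X`, it is a canonical generator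
and can be conjugated away; otherwise pass to `sXs`, whose canonical generators correspond to those
of `X` by `eta_simple_conj`. -/
theorem mem_closure_canonGens {X : Set W} (hc : ∀ r ∈ X, ∀ t ∈ X, r * t * r⁻¹ ∈ X)
    (hX : ∀ t ∈ X, cs.IsReflection t) (ω : List B) (j : B)
    (h : cs.wordProd ω * cs.simple j * (cs.wordProd ω)⁻¹ ∈ X) :
    cs.wordProd ω * cs.simple j * (cs.wordProd ω)⁻¹ ∈ Subgroup.closure (cs.canonGens X) := by
  have hsimple : ∀ {X : Set W} {i : B}, cs.simple i ∈ X → cs.simple i ∈ cs.canonGens X :=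
    fun {X i} hi => ⟨hi, fun t _ => (cs.eta_simple_eq_one_iff i t).1⟩
  induction ω generalizing X with
  | nil =>
    simp only [wordProd_nil, one_mul, inv_one, mul_one] at h ⊢
    exact Subgroup.subset_closure (hsimple h)
  | cons i ω ih =>
    set t := cs.wordProd ω * cs.simple j * (cs.wordProd ω)⁻¹ with ht
    have e : cs.wordProd (i :: ω) * cs.simple j * (cs.wordProd (i :: ω))⁻¹ =
        cs.simple i * t * cs.simple i := by
      simp [ht, wordProd_cons, mul_assoc]
    rw [e] at h ⊢
    by_cases hi : cs.simple i ∈ X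
    · have htX : t ∈ X := by
        have := hc _ hi _ h
        simpa [mul_assoc] using this
      have hs := Subgroup.subset_closure (hsimple hi)
      exact mul_mem (mul_mem hs (ih hc hX htX)) hs
    · refine cs.simple_mul_mul_simple_mem_closure ?_
        (ih (cs.conj_mem_simpleConj hc) (cs.isReflection_of_mem_simpleConj hX) h)
      rintro r ⟨hr, hr'⟩
      refine ⟨hr, fun t ht hrt => ?_⟩
      rw [← cs.eta_simple_conj hc hX hi hr ht] at hrt
      have := hr' (cs.simple i * t * cs.simple i) (by simpa [simpleConj, mul_assoc] using ht)
        (by simpa [mul_assoc] using hrt)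
      rw [← this]
      simp [mul_assoc]

/-- Exchange condition for canonical generators: the cocycle locates a factor that has the
transported `t` as an inversion, canonicity makes the two equal, and that factor is deleted. -/
theorem exists_prod_eq_mul_of_eta {X : Set W} (hc : ∀ r ∈ X, ∀ t ∈ X, r * t * r⁻¹ ∈ X)
    (hX : ∀ t ∈ X, cs.IsReflection t) (l : List W) (hl : ∀ r ∈ l, r ∈ cs.canonGens X) {t : W}
    (ht : t ∈ X) (h : cs.eta l.prod t = 1) :
    ∃ l' : List W, (∀ r ∈ l', r ∈ cs.canonGens X) ∧ l'.length < l.length ∧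
      l'.prod = t * l.prod := by
  induction l generalizing t with
  | nil => simp [eta_one] at h
  | cons r l ih =>
    simp only [List.mem_cons, forall_eq_or_imp] at hl
    rw [List.prod_cons, eta_mul] at h
    rcases cs.eta_eq_zero_or_one r t with h0 | h1
    · rw [h0, zero_add] at h
      have hr := hX r hl.1.1
      obtain ⟨l', h₁, h₂, h₃⟩ := ih hl.2 (by
        have := hc r hl.1.1 t ht
        rwa [hr.inv] at this ⊢) h
      refine ⟨r :: l', by simpa using ⟨hl.1, h₁⟩, by simpa using h₂, ?_⟩
      rw [List.prod_cons, h₃, List.prod_cons]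
      group
    · obtain rfl := hl.1.2 t ht h1
      refine ⟨l, hl.2, by simp, ?_⟩
      rw [List.prod_cons, ← mul_assoc, (hX t ht).mul_self, one_mul]

/-- In a shortest expression by canonical generators the first factor is an inversion; otherwise the
exchange condition would shorten the expression. -/
theorem exists_eta_eq_one_of_mem_closure {X : Set W}
    (hc : ∀ r ∈ X, ∀ t ∈ X, r * t * r⁻¹ ∈ X) (hX : ∀ t ∈ X, cs.IsReflection t) {w : W}
    (hw : w ∈ Subgroup.closure X) (h1 : w ≠ 1) : ∃ t ∈ X, cs.eta w t = 1 := by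
  classical
  have hX' : X ⊆ Subgroup.closure (cs.canonGens X) := by
    intro t ht
    obtain ⟨x, i, rfl⟩ := hX t ht
    obtain ⟨ω, rfl⟩ := cs.wordProd_surjective x
    exact cs.mem_closure_canonGens hc hX ω i ht
  have hw' := (Subgroup.closure_le _).2 hX' hw
  have hex : ∃ n, ∃ l : List W, (∀ r ∈ l, r ∈ cs.canonGens X) ∧ l.prod = w ∧ l.length = n := by
    rw [← Subgroup.mem_toSubmonoid, Subgroup.closure_toSubmonoid] at hw'
    obtain ⟨l, hl, hlw⟩ := Submonoid.exists_list_of_mem_closure hw'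
    refine ⟨_, l, fun r hr => ?_, hlw, rfl⟩
    rcases hl r hr with h | h
    · exact h
    · rwa [← inv_inv r, (hX _ h.1).inv]
  obtain ⟨l, hl, hlw, hlen⟩ := Nat.find_spec hex
  cases l with
  | nil => exact absurd hlw.symm h1
  | cons r l =>
    simp only [List.mem_cons, forall_eq_or_imp] at hl
    have hr := hl.1.1
    refine ⟨r, hr, ?_⟩
    rcases cs.eta_eq_zero_or_one l.prod r with h0 | h0
    · rw [← hlw, List.prod_cons, eta_mul, (hX r hr).eta_self]
      simp [h0]
    · obtain ⟨l', h₁, h₂, h₃⟩ := cs.exists_prod_eq_mul_of_eta hc hX l hl.2 hr h0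
      exfalso
      refine Nat.find_min hex (m := l'.length) ?_ ⟨l', h₁, ?_, rfl⟩
      · rw [← hlen, List.length_cons]
        omega
      · rw [h₃, ← hlw, List.prod_cons]

/-- If a set of reflections is stable under conjugation by its elements, it contains every
reflection of the subgroup it generates. -/
theorem mem_of_isReflection_of_mem_closure {X : Set W}
    (hc : ∀ r ∈ X, ∀ t ∈ X, r * t * r⁻¹ ∈ X) (hX : ∀ t ∈ X, cs.IsReflection t) {t : W}
    (ht : cs.IsReflection t) (h : t ∈ Subgroup.closure X) : t ∈ X := by
  obtain ⟨x, j, rfl⟩ := ht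
  obtain ⟨ω, rfl⟩ := cs.wordProd_surjective x
  induction ω generalizing X with
  | nil =>
    simp only [wordProd_nil, one_mul, inv_one, mul_one] at h ⊢
    -- A simple reflection has no inversion but itself, so the inversion found in `X` must be it.
    obtain ⟨t, ht, h1⟩ := cs.exists_eta_eq_one_of_mem_closure hc hX h fun h => by
      have := cs.length_simple j
      simp [h] at this
    rwa [← (cs.eta_simple_eq_one_iff j t).1 h1]
  | cons i ω ih =>
    have e : cs.wordProd (i :: ω) * cs.simple j * (cs.wordProd (i :: ω))⁻¹ =
        cs.simple i * (cs.wordProd ω * cs.simple j * (cs.wordProd ω)⁻¹) * cs.simple i := by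
      simp [wordProd_cons, mul_assoc]
    rw [e] at h ⊢
    refine ih (cs.conj_mem_simpleConj hc) (cs.isReflection_of_mem_simpleConj hX) ?_
    have := cs.simple_mul_mul_simple_mem_closure (i := i) (Y := X) (X := cs.simpleConj i X)
      (fun t ht => by simpa [simpleConj, mul_assoc] using ht) h
    simpa [mul_assoc] using this

end ReflectionSubgroups

/-! ### Reduced alternating words and Matsumoto's theorem. -/

section Matsumoto

/-- The word `i j i ⋯` of length `m` that alternates between `i` and `j`, beginning with `i`. -/
def altWord (i j : B) : ℕ → List B
  | 0 => []
  | m + 1 => i :: altWord j i m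

@[simp]
theorem length_altWord (i j : B) (m : ℕ) : (altWord i j m).length = m := by
  induction m generalizing i j with
  | zero => rfl
  | succ m ih => simp [altWord, ih]

/-- `alternatingWord i j m` is fixed by its last letter `j`, so the parity of `m` decides its first
letter. -/
theorem alternatingWord_eq_altWord (i j : B) (m : ℕ) :
    alternatingWord i j m = if Even m then altWord i j m else altWord j i m := by
  induction m with
  | zero => simp [alternatingWord, altWord]
  | succ m ih =>
    rw [alternatingWord_succ', ih]
    by_cases hm : Even m <;> simp [hm, altWord, parity_simps]

theorem isReduced_cons_iff (i : B) (ω : List B) :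
    cs.IsReduced (i :: ω) ↔ cs.IsReduced ω ∧ ¬ cs.IsLeftDescent (cs.wordProd ω) i := by
  have h := cs.length_wordProd_le ω
  rw [not_isLeftDescent_iff, IsReduced, IsReduced, wordProd_cons, List.length_cons]
  rcases cs.length_simple_mul (cs.wordProd ω) i with h' | h' <;> omega

theorem eq_pow_mul_of_eta_altWord {i j : B} {k : ℕ} {t : W}
    (h : cs.eta (cs.wordProd (altWord i j k)) t = 1) :
    ∃ l < k, t = (cs.simple i * cs.simple j) ^ l * cs.simple i := by
  induction k generalizing i j t with
  | zero => simp [altWord, eta_one] at h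
  | succ k ih =>
    rw [altWord, wordProd_cons, eta_mul] at h
    rcases cs.eta_eq_zero_or_one (cs.simple i) t with h0 | h1
    · rw [h0, zero_add] at h
      obtain ⟨l, hl, h⟩ := ih h
      refine ⟨l + 1, by omega, ?_⟩
      rw [inv_simple] at h
      calc t = cs.simple i * (cs.simple i * t * cs.simple i) * cs.simple i := by simp [mul_assoc]
        _ = cs.simple i * ((cs.simple j * cs.simple i) ^ l * cs.simple j) * cs.simple i := by rw [h]
        _ = _ := by rw [← mul_assoc, ← mul_pow_mul, pow_succ, mul_assoc _ (cs.simple i) (cs.simple j)]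
    · exact ⟨0, by omega, by simpa using (cs.eta_simple_eq_one_iff i t).1 h1⟩

/-- Otherwise `s_j = (s_i s_j)^l s_i` with `l < k`, so `(s_i s_j)^(l + 1) = 1` below the order `M i
j`. -/
theorem not_isLeftDescent_altWord {i j : B} {k : ℕ}
    (hk : M i j = 0 ∨ k < M i j) :
    ¬ cs.IsLeftDescent (cs.wordProd (altWord i j k)) j := by
  rw [← eta_simple_right_eq_one_iff]
  intro h
  obtain ⟨l, hl, h⟩ := cs.eq_pow_mul_of_eta_altWord h
  have h1 : (cs.simple i * cs.simple j) ^ (l + 1) = 1 := by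
    rw [pow_succ, ← mul_assoc, ← h, simple_mul_simple_self]
  have := orderOf_dvd_of_pow_eq_one h1
  rw [orderOf_simple_mul_simple] at this
  rcases hk with hk | hk
  · simp [hk] at this
  · have := Nat.le_of_dvd (by omega) this
    omega

theorem isReduced_altWord {i j : B} {k : ℕ} (hk : M i j = 0 ∨ k ≤ M i j) :
    cs.IsReduced (altWord i j k) := by
  induction k generalizing i j with
  | zero => simp [altWord, IsReduced]
  | succ k ih =>
    rw [altWord, isReduced_cons_iff]
    rw [M.symmetric] at hk
    exact ⟨ih (by omega), cs.not_isLeftDescent_altWord (by omega)⟩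

theorem isReduced_alternatingWord {i j : B} {k : ℕ} (hk : M i j = 0 ∨ k ≤ M i j) :
    cs.IsReduced (alternatingWord i j k) := by
  rw [alternatingWord_eq_altWord]
  split_ifs
  · exact cs.isReduced_altWord hk
  · exact cs.isReduced_altWord (M.symmetric i j ▸ hk)

/-- Apply the exchange property for `s_i` to a reduced word starting with `altWord j i k`. As `s_i`
is not an inversion of that prefix, the deleted letter lies beyond it. -/
theorem exists_isReduced_altWord_append {w : W} {i j : B}
    (hi : cs.IsLeftDescent w i) (hj : cs.IsLeftDescent w j) {k : ℕ}
    (hk : M i j = 0 ∨ k ≤ M i j) :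
    ∃ ω, cs.wordProd (altWord i j k ++ ω) = w ∧ cs.IsReduced (altWord i j k ++ ω) := by
  induction k generalizing i j with
  | zero =>
    obtain ⟨ω, hω, rfl⟩ := cs.exists_isReduced w
    exact ⟨ω, rfl, hω⟩
  | succ k ih =>
    rw [M.symmetric] at hk
    obtain ⟨ω, rfl, hred⟩ := ih hj hi (by omega)
    have h0 : cs.eta (cs.wordProd (altWord j i k)) (cs.simple i) = 0 := by
      rw [← eta_ne_one_iff, ne_eq, eta_simple_right_eq_one_iff]
      exact cs.not_isLeftDescent_altWord (by omega)
    have hη := (cs.eta_simple_right_eq_one_iff i _).2 hi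
    rw [wordProd_append, eta_mul, h0, zero_add] at hη
    obtain ⟨n, hn, hget⟩ := List.getElem_of_mem (cs.mem_leftInvSeq_of_eta hη)
    have herase := cs.getD_leftInvSeq_mul_wordProd ω n
    rw [List.getD_eq_getElem _ _ hn, hget] at herase
    rw [length_leftInvSeq] at hn
    have hprod : cs.wordProd (altWord i j (k + 1) ++ ω.eraseIdx n) =
        cs.wordProd (altWord j i k ++ ω) := by
      rw [altWord, List.cons_append, wordProd_cons, wordProd_append, ← herase, wordProd_append]
      simp [mul_assoc]
    refine ⟨ω.eraseIdx n, hprod, ?_⟩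
    rw [IsReduced, hprod, hred.eq]
    simp only [List.length_append, length_altWord, List.length_eraseIdx_of_lt hn]
    omega

/-- Matsumoto's theorem: a family satisfying the braid relations takes the same product along any
two reduced words of an element. -/
theorem IsReduced.prod_map_eq {C : Type*} [Monoid C] {f : B → C}
    (hf : ∀ i j, ((braidWord M i j).map f).prod = ((braidWord M j i).map f).prod)
    {ω ω' : List B} (hω : cs.IsReduced ω) (hω' : cs.IsReduced ω')
    (h : cs.wordProd ω = cs.wordProd ω') : (ω.map f).prod = (ω'.map f).prod := by
  obtain ⟨n, hn⟩ : ∃ n, ω.length = n := ⟨_, rfl⟩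
  induction n generalizing ω ω' with
  | zero =>
    have h2 : ω'.length = 0 := by rw [← hω'.eq, ← h, hω.eq, hn]
    rw [List.length_eq_zero_iff.1 hn, List.length_eq_zero_iff.1 h2]
  | succ n ih =>
    have hlen : ω'.length = n + 1 := by rw [← hω'.eq, ← h, hω.eq, hn]
    obtain ⟨i, ω, rfl⟩ := List.exists_cons_of_length_eq_add_one hn
    obtain ⟨j, ω', rfl⟩ := List.exists_cons_of_length_eq_add_one hlen
    have key : ∀ {a : B} {α β : List B}, cs.IsReduced (a :: α) → cs.IsReduced (a :: β) →
        cs.wordProd (a :: α) = cs.wordProd (a :: β) → α.length = n →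
        ((a :: α).map f).prod = ((a :: β).map f).prod := by
      intro a α β hα hβ hαβ hl
      rw [wordProd_cons, wordProd_cons, mul_right_inj] at hαβ
      simp only [List.map_cons, List.prod_cons]
      rw [ih ((cs.isReduced_cons_iff a α).1 hα).1 ((cs.isReduced_cons_iff a β).1 hβ).1 hαβ hl]
    have hdesc : ∀ {a : B} {α : List B}, cs.IsReduced (a :: α) →
        cs.IsLeftDescent (cs.wordProd (a :: α)) a := by
      intro a α hα
      rw [IsLeftDescent, hα.eq, wordProd_cons, simple_mul_simple_cancel_left,
        ((cs.isReduced_cons_iff a α).1 hα).1.eq, List.length_cons]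
      omega
    simp only [List.length_cons, add_left_inj] at hn hlen
    by_cases hij : i = j
    · subst hij
      exact key hω hω' h hn
    have hi := hdesc hω
    have hj := hdesc hω'
    rw [← h] at hj
    -- For infinite order, a reduced word of this element of length `n + 1` would start with an
    -- alternating word of length `n + 2`.
    have hM : M i j ≠ 0 := by
      intro hM
      obtain ⟨α, h1, h2⟩ := cs.exists_isReduced_altWord_append hi hj (k := n + 2) (Or.inl hM)
      have := h2.eq
      rw [h1, hω.eq, List.length_append, length_altWord, List.length_cons] at this
      omega
    obtain ⟨m, hm⟩ := Nat.exists_eq_succ_of_ne_zero hM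
    obtain ⟨α, h1, h2⟩ := cs.exists_isReduced_altWord_append hi hj (k := M i j) (Or.inr le_rfl)
    have hbraid : ((altWord i j (M i j)).map f).prod = ((altWord j i (M i j)).map f).prod := by
      have := hf i j
      rw [braidWord, braidWord, M.symmetric j i, alternatingWord_eq_altWord,
        alternatingWord_eq_altWord] at this
      split_ifs at this
      exacts [this, this.symm]
    have hbraidW : cs.wordProd (altWord i j (M i j)) = cs.wordProd (altWord j i (M i j)) := by
      have := cs.wordProd_braidWord_eq i j
      rw [braidWord, braidWord, M.symmetric j i, alternatingWord_eq_altWord,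
        alternatingWord_eq_altWord] at this
      split_ifs at this
      exacts [this, this.symm]
    have h1' : cs.wordProd (altWord j i (M i j) ++ α) = cs.wordProd (i :: ω) := by
      rw [← h1, wordProd_append, wordProd_append, hbraidW]
    have h2' : cs.IsReduced (altWord j i (M i j) ++ α) := by
      rw [IsReduced, h1', ← h1, h2.eq]
      simp
    have e1 : ((i :: ω).map f).prod = ((altWord i j (M i j) ++ α).map f).prod := by
      rw [hm] at h1 h2 ⊢
      exact key hω h2 h1.symm hn
    have e2 : ((j :: ω').map f).prod = ((altWord j i (M i j) ++ α).map f).prod := by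
      rw [hm] at h1' h2' ⊢
      exact key hω' h2' (h.symm.trans h1'.symm) hlen
    rw [e1, e2, List.map_append, List.map_append, List.prod_append, List.prod_append, hbraid]

end Matsumoto

/-! ### The semilattice of finitely generated reflection subgroups. -/

section FGReflectionSubgroups

theorem exists_finset_mem_reflClosure {J : Set cs.Refl} {x : W} (hx : x ∈ cs.reflClosure J) :
    ∃ F : Finset cs.Refl, (F : Set cs.Refl) ⊆ J ∧ x ∈ cs.reflClosure (F : Set cs.Refl) := by
  classical
  induction hx using Subgroup.closure_induction with
  | mem x hx =>
    obtain ⟨t, ht, rfl⟩ := hx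
    exact ⟨{t}, by simpa using ht, Subgroup.subset_closure ⟨t, by simp, rfl⟩⟩
  | one => exact ⟨∅, by simp, one_mem _⟩
  | mul x y _ _ hx hy =>
    obtain ⟨F, hF, hx⟩ := hx
    obtain ⟨F', hF', hy⟩ := hy
    refine ⟨F ∪ F', by simp [hF, hF'], mul_mem ?_ ?_⟩
    · exact Subgroup.closure_mono (Set.image_mono (by simp)) hx
    · exact Subgroup.closure_mono (Set.image_mono (by simp)) hy
  | inv x _ hx =>
    obtain ⟨F, hF, hx⟩ := hx
    exact ⟨F, hF, inv_mem hx⟩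

/-- Each of finitely many generators already lies in the subgroup generated by finitely many of the
reflections. -/
theorem isReflectionSubgroup_and_fg_iff (H : Subgroup W) :
    cs.IsReflectionSubgroup H ∧ H.FG ↔
      ∃ F : Finset cs.Refl, cs.reflClosure (F : Set cs.Refl) = H := by
  classical
  constructor
  · rintro ⟨⟨J, rfl⟩, S, hS⟩
    have hmem : ∀ x : S, x.1 ∈ cs.reflClosure J := fun x => by
      rw [← hS]; exact Subgroup.subset_closure x.2
    choose F hFJ hF using fun x : S => cs.exists_finset_mem_reflClosure (hmem x)
    refine ⟨Finset.univ.biUnion F, le_antisymm ?_ ?_⟩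
    · refine Subgroup.closure_mono (Set.image_mono ?_)
      simpa using hFJ
    · rw [← hS, Subgroup.closure_le]
      intro x hx
      refine Subgroup.closure_mono (Set.image_mono ?_) (hF ⟨x, hx⟩)
      exact_mod_cast Finset.subset_biUnion_of_mem F (Finset.mem_univ _)
  · rintro ⟨F, rfl⟩
    exact ⟨⟨_, rfl⟩, F.image Subtype.val, by rw [Finset.coe_image]; rfl⟩

theorem reflClosure_union (J K : Set cs.Refl) :
    cs.reflClosure (J ∪ K) = cs.reflClosure J ⊔ cs.reflClosure K := by
  rw [reflClosure, Set.image_union, Subgroup.closure_union]; rfl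

theorem reflClosure_image_conjRefl (w : W) (J : Set cs.Refl) :
    cs.reflClosure (cs.conjRefl w '' J) = (cs.reflClosure J).map (MulAut.conj w).toMonoidHom := by
  rw [reflClosure, reflClosure, MonoidHom.map_closure, Set.image_image, Set.image_image]
  rfl

instance : SemilatticeSup cs.FGReflectionSubgroup := Subtype.semilatticeSup <| by
  classical
  intro H K hH hK
  rw [isReflectionSubgroup_and_fg_iff] at hH hK ⊢
  obtain ⟨F, rfl⟩ := hH
  obtain ⟨F', rfl⟩ := hK
  exact ⟨F ∪ F', by rw [Finset.coe_union, reflClosure_union]⟩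

instance : OrderBot cs.FGReflectionSubgroup := Subtype.orderBot <| by
  rw [isReflectionSubgroup_and_fg_iff]
  exact ⟨∅, by simp [reflClosure]⟩

theorem coe_sup (H K : cs.FGReflectionSubgroup) : (H ⊔ K).1 = H.1 ⊔ K.1 := rfl

/-- The reflection subgroup generated by a finite set of reflections. -/
def fgClosure (F : Finset cs.Refl) : cs.FGReflectionSubgroup :=
  ⟨cs.reflClosure F, (cs.isReflectionSubgroup_and_fg_iff _).2 ⟨F, rfl⟩⟩

theorem exists_fgClosure_eq (H : cs.FGReflectionSubgroup) : ∃ F, cs.fgClosure F = H := by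
  obtain ⟨F, hF⟩ := (cs.isReflectionSubgroup_and_fg_iff _).1 H.2
  exact ⟨F, Subtype.ext hF⟩

/-- The reflection subgroup generated by one reflection. -/
def reflZ (t : cs.Refl) : cs.FGReflectionSubgroup := cs.fgClosure {t}

theorem coe_reflZ (t : cs.Refl) : (cs.reflZ t).1 = Subgroup.closure {t.1} := by
  simp [reflZ, fgClosure, reflClosure]

theorem fgClosure_empty : cs.fgClosure ∅ = ⊥ :=
  Subtype.ext (by simp [fgClosure, reflClosure])

theorem fgClosure_union [DecidableEq cs.Refl] (F F' : Finset cs.Refl) :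
    cs.fgClosure (F ∪ F') = cs.fgClosure F ⊔ cs.fgClosure F' :=
  Subtype.ext <| by
    change cs.reflClosure (↑(F ∪ F') : Set cs.Refl) = _
    rw [Finset.coe_union, reflClosure_union]
    rfl

theorem fgClosure_insert [DecidableEq cs.Refl] (t : cs.Refl) (F : Finset cs.Refl) :
    cs.fgClosure (insert t F) = cs.reflZ t ⊔ cs.fgClosure F := by
  rw [Finset.insert_eq, fgClosure_union]; rfl

/-- The conjugate `w H w⁻¹` of a finitely generated reflection subgroup. -/
def conjFG (w : W) (H : cs.FGReflectionSubgroup) : cs.FGReflectionSubgroup :=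
  ⟨H.1.map (MulAut.conj w).toMonoidHom, by
    classical
    obtain ⟨F, rfl⟩ := cs.exists_fgClosure_eq H
    rw [isReflectionSubgroup_and_fg_iff]
    exact ⟨F.image (cs.conjRefl w), by rw [Finset.coe_image, reflClosure_image_conjRefl]; rfl⟩⟩

theorem conjFG_sup (w : W) (H K : cs.FGReflectionSubgroup) :
    cs.conjFG w (H ⊔ K) = cs.conjFG w H ⊔ cs.conjFG w K :=
  Subtype.ext (Subgroup.map_sup _ _ _)

theorem conjFG_bot (w : W) : cs.conjFG w ⊥ = ⊥ :=
  Subtype.ext (Subgroup.map_bot _)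

theorem conjFG_conjFG (x y : W) (H : cs.FGReflectionSubgroup) :
    cs.conjFG x (cs.conjFG y H) = cs.conjFG (x * y) H :=
  Subtype.ext (by simp only [conjFG, Subgroup.map_map, map_mul]; rfl)

theorem conjFG_one (H : cs.FGReflectionSubgroup) : cs.conjFG 1 H = H :=
  Subtype.ext (by
    simp only [conjFG, map_one]
    exact Subgroup.map_id _)

theorem conjFG_simple_conjFG_simple (i : B) (H : cs.FGReflectionSubgroup) :
    cs.conjFG (cs.simple i) (cs.conjFG (cs.simple i) H) = H := by
  rw [conjFG_conjFG, simple_mul_simple_self, conjFG_one]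

theorem conjFG_fgClosure [DecidableEq cs.Refl] (w : W) (F : Finset cs.Refl) :
    cs.conjFG w (cs.fgClosure F) = cs.fgClosure (F.image (cs.conjRefl w)) :=
  Subtype.ext <| by
    change _ = cs.reflClosure (↑(F.image (cs.conjRefl w)) : Set cs.Refl)
    rw [Finset.coe_image, reflClosure_image_conjRefl]
    rfl

theorem conjFG_reflZ (w : W) (t : cs.Refl) :
    cs.conjFG w (cs.reflZ t) = cs.reflZ (cs.conjRefl w t) := by
  classical
  rw [reflZ, conjFG_fgClosure, Finset.image_singleton]; rfl

/-- The lattice form of the relation `e_t e_{t₁} = e_t e_{t t₁ t⁻¹}`. One inclusion suffices: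
applied to the conjugate subgroup it gives the other, as `t` is an involution. -/
theorem conjFG_sup_reflZ (t : cs.Refl) (H : cs.FGReflectionSubgroup) :
    cs.conjFG t.1 H ⊔ cs.reflZ t = H ⊔ cs.reflZ t := by
  have key : ∀ H : cs.FGReflectionSubgroup, cs.conjFG t.1 H ⊔ cs.reflZ t ≤ H ⊔ cs.reflZ t := by
    intro H
    refine sup_le ?_ le_sup_right
    change (cs.conjFG t.1 H).1 ≤ (H ⊔ cs.reflZ t).1
    rintro _ ⟨x, hx, rfl⟩
    have ht : t.1 ∈ (H ⊔ cs.reflZ t).1 := by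
      rw [coe_sup, coe_reflZ]
      exact Subgroup.mem_sup_right (Subgroup.subset_closure rfl)
    have hx' : x ∈ (H ⊔ cs.reflZ t).1 := by
      rw [coe_sup]
      exact Subgroup.mem_sup_left hx
    exact mul_mem (mul_mem ht hx') (inv_mem ht)
  refine le_antisymm (key H) ?_
  have h := key (cs.conjFG t.1 H)
  rwa [conjFG_conjFG, t.2.mul_self, conjFG_one] at h

theorem conjFG_simple_sup_reflZ (i : B) (H : cs.FGReflectionSubgroup) :
    cs.conjFG (cs.simple i) H ⊔ cs.reflZ (cs.simpleRefl i) = H ⊔ cs.reflZ (cs.simpleRefl i) :=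
  cs.conjFG_sup_reflZ (cs.simpleRefl i) H

end FGReflectionSubgroups

/-! ### Left and right multiplication operators on the free module. -/

section Representation

variable {k : Type*} [CommRing k] (u : B → k)

/-- Left multiplication by `e_K` in the regular representation. -/
noncomputable def opE (k : Type*) [CommRing k] (K : cs.FGReflectionSubgroup) :
    Module.End k (cs.FGReflectionSubgroup × W →₀ k) :=
  Finsupp.lmapDomain k k fun p => (K ⊔ p.1, p.2)

open Classical in
/-- Left multiplication by `g_s` in the regular representation. -/
noncomputable def opG (i : B) : Module.End k (cs.FGReflectionSubgroup × W →₀ k) :=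
  Finsupp.linearCombination k fun p =>
    Finsupp.single (cs.conjFG (cs.simple i) p.1, cs.simple i * p.2) 1 +
      if cs.IsLeftDescent p.2 i then
        (u i - 1) • (Finsupp.single (p.1 ⊔ cs.reflZ (cs.simpleRefl i), cs.simple i * p.2) 1 +
          Finsupp.single (p.1 ⊔ cs.reflZ (cs.simpleRefl i), p.2) 1)
      else 0

open Classical in
/-- Right multiplication by `g_s` in the regular representation. -/
noncomputable def opR (j : B) : Module.End k (cs.FGReflectionSubgroup × W →₀ k) :=
  Finsupp.linearCombination k fun p =>
    Finsupp.single (p.1, p.2 * cs.simple j) 1 +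
      if cs.IsRightDescent p.2 j then
        (u j - 1) •
          (Finsupp.single (p.1 ⊔ cs.reflZ (cs.conjRefl p.2 (cs.simpleRefl j)),
              p.2 * cs.simple j) 1 +
            Finsupp.single (p.1 ⊔ cs.reflZ (cs.conjRefl p.2 (cs.simpleRefl j)), p.2) 1)
      else 0

theorem opE_single (K H : cs.FGReflectionSubgroup) (w : W) :
    cs.opE k K (Finsupp.single (H, w) 1) = Finsupp.single (K ⊔ H, w) 1 := by
  simp [opE]

open Classical in
theorem opG_single (i : B) (H : cs.FGReflectionSubgroup) (w : W) :
    cs.opG u i (Finsupp.single (H, w) 1) =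
      Finsupp.single (cs.conjFG (cs.simple i) H, cs.simple i * w) 1 +
      if cs.IsLeftDescent w i then
        (u i - 1) • (Finsupp.single (H ⊔ cs.reflZ (cs.simpleRefl i), cs.simple i * w) 1 +
          Finsupp.single (H ⊔ cs.reflZ (cs.simpleRefl i), w) 1)
      else 0 := by
  rw [opG, Finsupp.linearCombination_single, one_smul]

open Classical in
theorem opR_single (j : B) (H : cs.FGReflectionSubgroup) (w : W) :
    cs.opR u j (Finsupp.single (H, w) 1) =
      Finsupp.single (H, w * cs.simple j) 1 +
      if cs.IsRightDescent w j then
        (u j - 1) • (Finsupp.single (H ⊔ cs.reflZ (cs.conjRefl w (cs.simpleRefl j)),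
              w * cs.simple j) 1 +
            Finsupp.single (H ⊔ cs.reflZ (cs.conjRefl w (cs.simpleRefl j)), w) 1)
      else 0 := by
  rw [opR, Finsupp.linearCombination_single, one_smul]

variable {cs u} in
theorem end_ext {V : Type*} [AddCommGroup V] [Module k V]
    {f g : (cs.FGReflectionSubgroup × W →₀ k) →ₗ[k] V}
    (h : ∀ H w, f (Finsupp.single (H, w) 1) = g (Finsupp.single (H, w) 1)) : f = g :=
  Finsupp.lhom_ext' fun p => LinearMap.ext_ring (h p.1 p.2)

theorem opE_mul (K K' : cs.FGReflectionSubgroup) : cs.opE k K * cs.opE k K' = cs.opE k (K ⊔ K') :=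
  end_ext fun H w => by
    rw [Module.End.mul_apply, opE_single, opE_single, opE_single, sup_assoc]

theorem opG_mul_opE (i : B) (K : cs.FGReflectionSubgroup) :
    cs.opG u i * cs.opE k K = cs.opE k (cs.conjFG (cs.simple i) K) * cs.opG u i := by
  classical
  refine end_ext fun H w => ?_
  rw [Module.End.mul_apply, Module.End.mul_apply, opE_single, opG_single, opG_single, map_add,
    opE_single, conjFG_sup, apply_ite (cs.opE k _), map_zero, map_smul, map_add, opE_single,
    opE_single]
  have h : cs.conjFG (cs.simple i) K ⊔ (H ⊔ cs.reflZ (cs.simpleRefl i)) =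
      K ⊔ H ⊔ cs.reflZ (cs.simpleRefl i) := by
    rw [sup_comm H, ← sup_assoc, conjFG_simple_sup_reflZ]
    ac_rfl
  rw [h]

theorem opG_mul_self (i : B) : cs.opG u i * cs.opG u i =
    1 + (u i - 1) • cs.opE k (cs.reflZ (cs.simpleRefl i)) * (1 + cs.opG u i) := by
  classical
  refine end_ext fun H w => ?_
  have h1 := cs.conjFG_simple_conjFG_simple i H
  have h2 := cs.conjFG_simple_sup_reflZ i
  have h3 := cs.isLeftDescent_iff_not_isLeftDescent_mul (w := w) (i := i)
  have h4 : cs.reflZ (cs.simpleRefl i) ⊔ H = H ⊔ cs.reflZ (cs.simpleRefl i) := sup_comm _ _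
  have h5 : cs.reflZ (cs.simpleRefl i) ⊔ (H ⊔ cs.reflZ (cs.simpleRefl i)) =
    H ⊔ cs.reflZ (cs.simpleRefl i) := by rw [sup_comm, sup_assoc, sup_idem]
  have h6 : cs.reflZ (cs.simpleRefl i) ⊔ cs.conjFG (cs.simple i) H =
    H ⊔ cs.reflZ (cs.simpleRefl i) := by rw [sup_comm, h2]
  have h7 : cs.conjFG (cs.simple i) (H ⊔ cs.reflZ (cs.simpleRefl i)) =
      H ⊔ cs.reflZ (cs.simpleRefl i) := by
    rw [conjFG_sup, ← h2 H, conjFG_reflZ]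
    congr 2
    exact Subtype.ext (by simp [conjRefl, simpleRefl])
  by_cases hw : cs.IsLeftDescent w i
  · have hw' := h3.1 hw
    simp only [Module.End.mul_apply, LinearMap.add_apply, LinearMap.smul_apply,
      Module.End.one_apply, opG_single, opE_single, if_pos hw, if_neg hw', map_add, map_smul,
      h1, h4, h5, h6, h7, simple_mul_simple_cancel_left, sup_assoc, sup_idem]
    module
  · have hw' : cs.IsLeftDescent (cs.simple i * w) i := by
      by_contra hc
      exact hw (h3.2 hc)
    simp only [Module.End.mul_apply, LinearMap.add_apply, LinearMap.smul_apply,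
      Module.End.one_apply, opG_single, opE_single, if_neg hw, if_pos hw', map_add,
      h1, h2, h4, h6, simple_mul_simple_cancel_left, map_zero]
    module

/-- If `s w = w s'`, then `s` and `s'` are conjugate, so their parameters agree, and `w s' w⁻¹ = s`
makes both operators join the same reflection. Otherwise the left and right descent conditions do
not affect each other, and only joins have to be rearranged. -/
theorem commute_opG_opR (hu : ∀ i j : B, IsConj (cs.simple i) (cs.simple j) → u i = u j)
    (i j : B) : Commute (cs.opG u i) (cs.opR u j) := by
  classical
  refine end_ext fun H w => ?_
  have h1 := cs.conjFG_simple_conjFG_simple i H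
  have h2 := cs.conjFG_simple_sup_reflZ i
  have hr : cs.reflZ (cs.conjRefl (cs.simple i * w) (cs.simpleRefl j)) =
      cs.conjFG (cs.simple i) (cs.reflZ (cs.conjRefl w (cs.simpleRefl j))) := by
    rw [conjFG_reflZ]
    congr 1
    exact Subtype.ext (by simp [conjRefl, mul_assoc])
  by_cases h : cs.simple i * w = w * cs.simple j
  · have hconj : u i = u j := hu i j <| isConj_comm.1 <| isConj_iff.2 ⟨w, by rw [← h]; simp⟩
    have hrefl : cs.conjRefl w (cs.simpleRefl j) = cs.simpleRefl i :=
      Subtype.ext (by simp [conjRefl, simpleRefl, ← h])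
    have hrefl' : cs.conjFG (cs.simple i) (cs.reflZ (cs.simpleRefl i)) =
        cs.reflZ (cs.simpleRefl i) := by
      rw [conjFG_reflZ]
      congr 1
      exact Subtype.ext (by simp [conjRefl, simpleRefl])
    have hd : cs.IsRightDescent w j ↔ cs.IsLeftDescent w i := by
      rw [IsRightDescent, IsLeftDescent, h]
    have hL := cs.isLeftDescent_iff_not_isLeftDescent_mul (w := w) (i := i)
    have hcancel : cs.simple i * w * cs.simple j = w := by rw [h]; simp
    have hd' : cs.IsRightDescent (cs.simple i * w) j ↔
        cs.IsLeftDescent (cs.simple i * w) i := by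
      rw [IsRightDescent, IsLeftDescent, hcancel, simple_mul_simple_cancel_left]
    by_cases hw : cs.IsLeftDescent w i
    · have hw' := hL.1 hw
      simp only [Module.End.mul_apply, opG_single, opR_single, hr, hrefl, hrefl', ← h, hd, hd', hw,
        hw', hconj, hcancel, if_true, if_false, map_add, map_smul, conjFG_sup, h2,
        simple_mul_simple_cancel_left, sup_assoc, sup_idem]
    · have hw' : cs.IsLeftDescent (cs.simple i * w) i := by
        by_contra hc
        exact hw (hL.2 hc)
      simp only [Module.End.mul_apply, opG_single, opR_single, hr, hrefl, hrefl', ← h, hd, hd', hw,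
        hw', hconj, hcancel, if_true, if_false, h2, simple_mul_simple_cancel_left, add_zero]
  · have hL := cs.isLeftDescent_mul_simple_iff h
    have hR := cs.isRightDescent_simple_mul_iff h
    have e1 : ∀ r, H ⊔ cs.reflZ (cs.simpleRefl i) ⊔ r = H ⊔ r ⊔ cs.reflZ (cs.simpleRefl i) :=
      fun r => sup_right_comm _ _ _
    have e2 : ∀ r, H ⊔ cs.conjFG (cs.simple i) r ⊔ cs.reflZ (cs.simpleRefl i) =
        H ⊔ r ⊔ cs.reflZ (cs.simpleRefl i) := fun r => by
      rw [sup_assoc, h2, ← sup_assoc]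
    by_cases hP : cs.IsLeftDescent w i <;> by_cases hQ : cs.IsRightDescent w j <;>
    · simp only [Module.End.mul_apply, opG_single, opR_single, hr, hL, hR, hP, hQ, e1, e2,
        if_true, if_false, map_add, map_smul, conjFG_sup, mul_assoc, add_zero]
      try module

end Representation

/-! ### The braid relation for the operators, and the regular representation. -/

section RegularRepresentation

variable {k : Type*} [CommRing k] (u : B → k)

theorem opE_bot : cs.opE k ⊥ = 1 :=
  end_ext fun H w => by rw [opE_single, bot_sup_eq, Module.End.one_apply]

theorem prod_map_opG_mul_opE (ω : List B) (K : cs.FGReflectionSubgroup) :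
    (ω.map (cs.opG u)).prod * cs.opE k K =
      cs.opE k (cs.conjFG (cs.wordProd ω) K) * (ω.map (cs.opG u)).prod := by
  induction ω with
  | nil => simp [conjFG_one]
  | cons i ω ih =>
    rw [List.map_cons, List.prod_cons, mul_assoc, ih, ← mul_assoc, opG_mul_opE, conjFG_conjFG,
      wordProd_cons, mul_assoc]

theorem prod_map_opG_single_bot_one {ω : List B} (hω : cs.IsReduced ω) :
    (ω.map (cs.opG u)).prod (Finsupp.single (⊥, 1) 1) =
      Finsupp.single (⊥, cs.wordProd ω) 1 := by
  classical
  induction ω with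
  | nil => simp
  | cons i ω ih =>
    obtain ⟨h, hi⟩ := (cs.isReduced_cons_iff i ω).1 hω
    rw [List.map_cons, List.prod_cons, Module.End.mul_apply, ih h, opG_single, if_neg hi, add_zero,
      conjFG_bot, wordProd_cons]

/-- The vector `(⊥, 1)` generates everything: `opR` along a reduced word reaches `(⊥, w)`, then
`opE` reaches `(H, w)`, and both kinds of operator can be moved past `f` and `f'`. -/
theorem eq_of_commute_opR {f f' : Module.End k (cs.FGReflectionSubgroup × W →₀ k)}
    (hf : ∀ j, Commute f (cs.opR u j)) (hf' : ∀ j, Commute f' (cs.opR u j)) {x : W}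
    (he : ∀ K, f * cs.opE k K = cs.opE k (cs.conjFG x K) * f)
    (he' : ∀ K, f' * cs.opE k K = cs.opE k (cs.conjFG x K) * f')
    (h : f (Finsupp.single (⊥, 1) 1) = f' (Finsupp.single (⊥, 1) 1)) : f = f' := by
  classical
  have key : ∀ n, ∀ w : W, cs.length w = n →
      f (Finsupp.single (⊥, w) 1) = f' (Finsupp.single (⊥, w) 1) := by
    intro n
    induction n with
    | zero =>
      intro w hw
      rw [cs.length_eq_zero_iff.1 hw, h]
    | succ n ih =>
      intro w hw
      obtain ⟨j, hj⟩ := cs.exists_rightDescent_of_ne_one (w := w) (by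
        rintro rfl
        simp at hw)
      have hR : cs.opR u j (Finsupp.single (⊥, w * cs.simple j) 1) =
          Finsupp.single (⊥, w) 1 := by
        rw [opR_single, if_neg (cs.isRightDescent_iff_not_isRightDescent_mul.1 hj), add_zero,
          simple_mul_simple_cancel_right]
      have hlen := (cs.isRightDescent_iff).1 hj
      rw [← hR, ← Module.End.mul_apply, ← Module.End.mul_apply, (hf j).eq, (hf' j).eq,
        Module.End.mul_apply, Module.End.mul_apply, ih _ (by omega)]
  refine end_ext fun H w => ?_
  have hE : cs.opE k H (Finsupp.single (⊥, w) 1) = Finsupp.single (H, w) 1 := by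
    rw [opE_single, sup_bot_eq]
  rw [← hE, ← Module.End.mul_apply, ← Module.End.mul_apply, he, he', Module.End.mul_apply,
    Module.End.mul_apply, key _ w rfl]

theorem opG_braid (hu : ∀ i j : B, IsConj (cs.simple i) (cs.simple j) → u i = u j) (i j : B) :
    ((braidWord M i j).map (cs.opG u)).prod = ((braidWord M j i).map (cs.opG u)).prod := by
  have hcomm : ∀ (ω : List B) (j : B), Commute (ω.map (cs.opG u)).prod (cs.opR u j) :=
    fun ω j => Commute.list_prod_left _ _ fun f hf => by
      obtain ⟨i, -, rfl⟩ := List.mem_map.1 hf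
      exact cs.commute_opG_opR u hu i j
  refine cs.eq_of_commute_opR u (hcomm _) (hcomm _) (cs.prod_map_opG_mul_opE u _) ?_ ?_
  · rw [wordProd_braidWord_eq]
    exact cs.prod_map_opG_mul_opE u _
  · rw [cs.prod_map_opG_single_bot_one u (cs.isReduced_alternatingWord (Or.inr le_rfl)),
      cs.prod_map_opG_single_bot_one u (cs.isReduced_alternatingWord (Or.inr le_rfl)),
      wordProd_braidWord_eq]

/-- The action of the generators on the regular representation. -/
noncomputable def freeRep :
    FreeAlgebra k (B ⊕ cs.Refl) →ₐ[k] Module.End k (cs.FGReflectionSubgroup × W →₀ k) :=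
  FreeAlgebra.lift k (Sum.elim (cs.opG u) fun t => cs.opE k (cs.reflZ t))

theorem freeRep_freeG (i : B) : cs.freeRep u (cs.freeG i) = cs.opG u i := by
  simp [freeRep, freeG]

theorem freeRep_freeE (t : cs.Refl) : cs.freeRep u (cs.freeE t) = cs.opE k (cs.reflZ t) := by
  simp [freeRep, freeE]

theorem freeRep_rel (hu : ∀ i j : B, IsConj (cs.simple i) (cs.simple j) → u i = u j)
    {x y : FreeAlgebra k (B ⊕ cs.Refl)} (h : cs.AlgRel u x y) :
    cs.freeRep u x = cs.freeRep u y := by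
  have hprod : ∀ ω : List B,
      cs.freeRep u (ω.map cs.freeG).prod = (ω.map (cs.opG u)).prod := fun ω => by
    rw [map_list_prod, List.map_map]
    congr 2
    ext1 i
    exact cs.freeRep_freeG u i
  cases h with
  | braid i j => rw [hprod, hprod, opG_braid cs u hu]
  | e_idem t => rw [map_mul, freeRep_freeE, opE_mul, sup_idem]
  | e_comm t₁ t₂ =>
    rw [map_mul, map_mul, freeRep_freeE, freeRep_freeE, opE_mul, opE_mul, sup_comm]
  | e_conj t t₁ =>
    rw [map_mul, map_mul, freeRep_freeE, freeRep_freeE, freeRep_freeE, opE_mul, opE_mul,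
      ← conjFG_reflZ, sup_comm, sup_comm _ (cs.conjFG _ _), conjFG_sup_reflZ]
  | g_e i t =>
    rw [map_mul, map_mul, freeRep_freeE, freeRep_freeE, freeRep_freeG, opG_mul_opE, conjFG_reflZ]
  | g_sq i =>
    rw [map_mul, map_add, map_mul, map_mul, map_add, map_one, freeRep_freeE, freeRep_freeG,
      AlgHom.commutes, opG_mul_self, Algebra.smul_def]

/-- The regular representation of `C_W(u)` on the free module with basis the pairs `(H, w)`. -/
noncomputable def regRep
    (hu : ∀ i j : B, IsConj (cs.simple i) (cs.simple j) → u i = u j) :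
    cs.CAlg u →ₐ[k] Module.End k (cs.FGReflectionSubgroup × W →₀ k) :=
  RingQuot.liftAlgHom k ⟨cs.freeRep u, fun _ _ h => cs.freeRep_rel u hu h⟩

variable (hu : ∀ i j : B, IsConj (cs.simple i) (cs.simple j) → u i = u j)

theorem regRep_g (i : B) : cs.regRep u hu (cs.g u i) = cs.opG u i := by
  rw [regRep, g, RingQuot.liftAlgHom_mkAlgHom_apply, freeRep_freeG]

theorem regRep_e (t : cs.Refl) : cs.regRep u hu (cs.e u t) = cs.opE k (cs.reflZ t) := by
  rw [regRep, e, RingQuot.liftAlgHom_mkAlgHom_apply, freeRep_freeE]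

theorem regRep_gWord (ω : List B) :
    cs.regRep u hu (cs.gWord u ω) = (ω.map (cs.opG u)).prod := by
  rw [gWord, map_list_prod, List.map_map]
  congr 2
  ext1 i
  exact cs.regRep_g u hu i

end RegularRepresentation

/-! ### Identities in the algebra: `e_J` and `g_w`. -/

section Relations

variable {k : Type*} [CommRing k] (u : B → k)

theorem prod_map_g_braidWord (i j : B) :
    ((braidWord M i j).map (cs.g u)).prod = ((braidWord M j i).map (cs.g u)).prod := by
  have h := RingQuot.mkAlgHom_rel k (AlgRel.braid (cs := cs) (u := u) i j)
  rwa [map_list_prod, map_list_prod, List.map_map, List.map_map] at h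

theorem e_mul_self (t : cs.Refl) : cs.e u t * cs.e u t = cs.e u t := by
  have h := RingQuot.mkAlgHom_rel k (AlgRel.e_idem (cs := cs) (u := u) t)
  rwa [map_mul] at h

theorem e_mul_e_conjRefl (t t₁ : cs.Refl) :
    cs.e u t * cs.e u (cs.conjRefl t.1 t₁) = cs.e u t * cs.e u t₁ := by
  have h := RingQuot.mkAlgHom_rel k (AlgRel.e_conj (cs := cs) (u := u) t t₁)
  rw [map_mul, map_mul] at h
  exact h.symm

theorem g_mul_e (i : B) (t : cs.Refl) :
    cs.g u i * cs.e u t = cs.e u (cs.conjRefl (cs.simple i) t) * cs.g u i := by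
  have h := RingQuot.mkAlgHom_rel k (AlgRel.g_e (cs := cs) (u := u) i t)
  rwa [map_mul, map_mul] at h

theorem g_mul_self (i : B) :
    cs.g u i * cs.g u i = 1 + (u i - 1) • (cs.e u (cs.simpleRefl i) * (1 + cs.g u i)) := by
  have h := RingQuot.mkAlgHom_rel k (AlgRel.g_sq (cs := cs) (u := u) i)
  rw [map_mul, map_add, map_mul, map_mul, map_add, map_one, AlgHom.commutes, mul_assoc,
    ← Algebra.smul_def] at h
  exact h

theorem eProd_empty : cs.eProd u ∅ = 1 := Finset.noncommProd_empty _ _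

theorem eProd_insert_of_notMem [DecidableEq cs.Refl] {t : cs.Refl} {F : Finset cs.Refl}
    (ht : t ∉ F) : cs.eProd u (insert t F) = cs.e u t * cs.eProd u F :=
  Finset.noncommProd_insert_of_notMem _ _ _ _ ht

theorem commute_e_eProd (t : cs.Refl) (F : Finset cs.Refl) :
    Commute (cs.e u t) (cs.eProd u F) :=
  Finset.noncommProd_commute _ _ _ _ fun t' _ => cs.e_commute u t t'

theorem e_mul_eProd_of_mem {t : cs.Refl} {F : Finset cs.Refl} (ht : t ∈ F) :
    cs.e u t * cs.eProd u F = cs.eProd u F := by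
  classical
  rw [← Finset.insert_erase ht, eProd_insert_of_notMem cs u (Finset.notMem_erase _ _),
    ← mul_assoc, e_mul_self]

theorem eProd_insert [DecidableEq cs.Refl] (t : cs.Refl) (F : Finset cs.Refl) :
    cs.eProd u (insert t F) = cs.e u t * cs.eProd u F := by
  by_cases ht : t ∈ F
  · rw [Finset.insert_eq_of_mem ht, e_mul_eProd_of_mem cs u ht]
  · exact cs.eProd_insert_of_notMem u ht

/-- The set `X` of reflections absorbed by `e_F` contains `F` and, by `e_mul_e_conjRefl`, is stable
under conjugation by its elements; hence it contains all reflections of `⟨F⟩`. -/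
theorem eProd_mul_e_of_mem_reflClosure {F : Finset cs.Refl} {t : cs.Refl}
    (ht : t.1 ∈ cs.reflClosure (F : Set cs.Refl)) :
    cs.eProd u F * cs.e u t = cs.eProd u F := by
  set X : Set W := {x | ∃ t : cs.Refl, t.1 = x ∧ cs.eProd u F * cs.e u t = cs.eProd u F}
    with hXdef
  have hX : ∀ t ∈ X, cs.IsReflection t := by
    rintro _ ⟨t, rfl, -⟩
    exact t.2
  have hc : ∀ r ∈ X, ∀ t ∈ X, r * t * r⁻¹ ∈ X := by
    rintro _ ⟨r, rfl, hr⟩ _ ⟨t, rfl, ht⟩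
    refine ⟨cs.conjRefl r.1 t, rfl, ?_⟩
    rw [← hr, mul_assoc, e_mul_e_conjRefl, ← mul_assoc, hr, ht]
  have hF : cs.reflClosure (F : Set cs.Refl) ≤ Subgroup.closure X := by
    refine Subgroup.closure_mono ?_
    rintro _ ⟨r, hr, rfl⟩
    exact ⟨r, rfl, by rw [← (cs.commute_e_eProd u r F).eq, e_mul_eProd_of_mem cs u hr]⟩
  obtain ⟨t', ht', h⟩ := cs.mem_of_isReflection_of_mem_closure hc hX t.2 (hF ht)
  rwa [Subtype.ext ht'] at h

theorem eProd_mul_eProd_of_le {F F' : Finset cs.Refl}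
    (h : cs.fgClosure F' ≤ cs.fgClosure F) : cs.eProd u F * cs.eProd u F' = cs.eProd u F := by
  classical
  have hF' : ∀ t ∈ F', t.1 ∈ cs.reflClosure (F : Set cs.Refl) := fun t ht =>
    h (Subgroup.subset_closure ⟨t, ht, rfl⟩)
  clear h
  induction F' using Finset.induction_on with
  | empty => rw [eProd_empty, mul_one]
  | insert t F' _ ih =>
    rw [eProd_insert, ← mul_assoc,
      eProd_mul_e_of_mem_reflClosure cs u (hF' t (Finset.mem_insert_self _ _)),
      ih fun t ht => hF' t (Finset.mem_insert_of_mem ht)]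

/-- The element `e_J` depends only on the subgroup generated by `J`. -/
theorem eProd_eq_of_fgClosure_eq {F F' : Finset cs.Refl}
    (h : cs.fgClosure F = cs.fgClosure F') : cs.eProd u F = cs.eProd u F' := by
  have hcomm : Commute (cs.eProd u F') (cs.eProd u F) :=
    Finset.noncommProd_commute _ _ _ _ fun t _ => (cs.commute_e_eProd u t F').symm
  rw [← cs.eProd_mul_eProd_of_le u h.ge, ← hcomm.eq, cs.eProd_mul_eProd_of_le u h.le]

theorem g_mul_eProd [DecidableEq cs.Refl] (i : B) (F : Finset cs.Refl) :
    cs.g u i * cs.eProd u F =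
      cs.eProd u (F.image (cs.conjRefl (cs.simple i))) * cs.g u i := by
  induction F using Finset.induction_on with
  | empty => simp [eProd_empty]
  | insert t F _ ih =>
    rw [eProd_insert, ← mul_assoc, g_mul_e, mul_assoc, ih, Finset.image_insert, eProd_insert,
      mul_assoc]

/-- The element `g_w`. -/
noncomputable def gElt (w : W) : cs.CAlg u := cs.gWord u (cs.exists_isReduced w).choose

variable {cs} in
theorem IsReduced.gWord_eq {ω : List B} (hω : cs.IsReduced ω) :
    cs.gWord u ω = cs.gElt u (cs.wordProd ω) :=
  have h := (cs.exists_isReduced (cs.wordProd ω)).choose_spec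
  hω.prod_map_eq cs (cs.prod_map_g_braidWord u) h.1 h.2

theorem gElt_one : cs.gElt u 1 = 1 := by
  have h := IsReduced.gWord_eq (cs := cs) u (ω := []) (by simp [IsReduced])
  rw [wordProd_nil] at h
  rw [← h]
  simp [gWord]

theorem g_mul_gElt {i : B} {w : W} (h : ¬ cs.IsLeftDescent w i) :
    cs.g u i * cs.gElt u w = cs.gElt u (cs.simple i * w) := by
  obtain ⟨ω, hω, rfl⟩ := cs.exists_isReduced w
  rw [← hω.gWord_eq, ← wordProd_cons, ← ((cs.isReduced_cons_iff i ω).2 ⟨hω, h⟩).gWord_eq]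
  simp [gWord]

theorem g_mul_gElt_of_isLeftDescent {i : B} {w : W} (h : cs.IsLeftDescent w i) :
    cs.g u i * cs.gElt u w = cs.gElt u (cs.simple i * w) +
      (u i - 1) • (cs.e u (cs.simpleRefl i) *
        (cs.gElt u (cs.simple i * w) + cs.gElt u w)) := by
  have h' := cs.g_mul_gElt u (cs.isLeftDescent_iff_not_isLeftDescent_mul.1 h)
  rw [simple_mul_simple_cancel_left] at h'
  rw [← h', ← mul_assoc, g_mul_self, add_mul, one_mul, smul_mul_assoc, mul_assoc, add_mul, one_mul]

end Relations

/-! ### The isomorphism with the free module. -/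

section Basis

variable {k : Type*} [CommRing k] (u : B → k)
  (rep : cs.FGReflectionSubgroup → Finset cs.Refl)

/-- The linear map sending the basis vector `(H, w)` to `e_H g_w`. -/
noncomputable def toCAlg : (cs.FGReflectionSubgroup × W →₀ k) →ₗ[k] cs.CAlg u :=
  Finsupp.linearCombination k fun p => cs.eProd u (rep p.1) * cs.gElt u p.2

theorem toCAlg_single (H : cs.FGReflectionSubgroup) (w : W) :
    cs.toCAlg u rep (Finsupp.single (H, w) 1) = cs.eProd u (rep H) * cs.gElt u w := by
  rw [toCAlg, Finsupp.linearCombination_single, one_smul]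

variable {rep}

theorem toCAlg_opE (hrep : ∀ H, cs.fgClosure (rep H) = H) (t : cs.Refl)
    (x : cs.FGReflectionSubgroup × W →₀ k) :
    cs.toCAlg u rep (cs.opE k (cs.reflZ t) x) = cs.e u t * cs.toCAlg u rep x := by
  classical
  have h : cs.toCAlg u rep ∘ₗ cs.opE k (cs.reflZ t) =
      LinearMap.mulLeft k (cs.e u t) ∘ₗ cs.toCAlg u rep := end_ext fun H w => by
    rw [LinearMap.comp_apply, LinearMap.comp_apply, opE_single, toCAlg_single, toCAlg_single,
      LinearMap.mulLeft_apply, ← mul_assoc, ← eProd_insert]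
    congr 1
    apply cs.eProd_eq_of_fgClosure_eq
    rw [hrep, fgClosure_insert, hrep]
  exact LinearMap.congr_fun h x

theorem toCAlg_opG (hrep : ∀ H, cs.fgClosure (rep H) = H) (i : B)
    (x : cs.FGReflectionSubgroup × W →₀ k) :
    cs.toCAlg u rep (cs.opG u i x) = cs.g u i * cs.toCAlg u rep x := by
  classical
  have h : cs.toCAlg u rep ∘ₗ cs.opG u i =
      LinearMap.mulLeft k (cs.g u i) ∘ₗ cs.toCAlg u rep := end_ext fun H w => by
    have h1 : cs.eProd u ((rep H).image (cs.conjRefl (cs.simple i))) =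
        cs.eProd u (rep (cs.conjFG (cs.simple i) H)) := by
      apply cs.eProd_eq_of_fgClosure_eq
      rw [hrep, ← conjFG_fgClosure, hrep]
    -- Once `s` is joined, `sHs` and `H` generate the same subgroup; this is why the descent term of
    -- `opG` can involve `H` unconjugated.
    have h2 : cs.eProd u (rep (cs.conjFG (cs.simple i) H)) * cs.e u (cs.simpleRefl i) =
        cs.eProd u (rep (H ⊔ cs.reflZ (cs.simpleRefl i))) := by
      rw [← (cs.commute_e_eProd u _ _).eq, ← eProd_insert]
      apply cs.eProd_eq_of_fgClosure_eq
      rw [hrep, fgClosure_insert, hrep, sup_comm, conjFG_simple_sup_reflZ]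
    rw [LinearMap.comp_apply, LinearMap.comp_apply, opG_single, toCAlg_single,
      LinearMap.mulLeft_apply, ← mul_assoc, g_mul_eProd, mul_assoc, h1]
    split_ifs with hw
    · simp only [map_add, map_smul, toCAlg_single]
      rw [g_mul_gElt_of_isLeftDescent cs u hw, mul_add, mul_smul_comm, ← mul_assoc, h2, mul_add]
    · rw [add_zero, toCAlg_single, g_mul_gElt cs u hw]
  exact LinearMap.congr_fun h x

theorem toCAlg_regRep (hrep : ∀ H, cs.fgClosure (rep H) = H)
    (hu : ∀ i j : B, IsConj (cs.simple i) (cs.simple j) → u i = u j)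
    (c : cs.CAlg u) (x : cs.FGReflectionSubgroup × W →₀ k) :
    cs.toCAlg u rep (cs.regRep u hu c x) = c * cs.toCAlg u rep x := by
  obtain ⟨c, rfl⟩ := RingQuot.mkAlgHom_surjective k (cs.AlgRel u) c
  induction c using FreeAlgebra.induction generalizing x with
  | grade0 r =>
    rw [AlgHom.commutes, AlgHom.commutes, Module.algebraMap_end_apply, map_smul, Algebra.smul_def]
  | grade1 a =>
    cases a with
    | inl i =>
      change cs.toCAlg u rep (cs.regRep u hu (cs.g u i) x) = cs.g u i * _
      rw [regRep_g, toCAlg_opG cs u hrep]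
    | inr t =>
      change cs.toCAlg u rep (cs.regRep u hu (cs.e u t) x) = cs.e u t * _
      rw [regRep_e, toCAlg_opE cs u hrep]
  | mul a b ha hb => rw [map_mul, map_mul, Module.End.mul_apply, ha, hb, mul_assoc]
  | add a b ha hb => rw [map_add, map_add, LinearMap.add_apply, map_add, ha, hb, add_mul]

theorem regRep_eProd
    (hu : ∀ i j : B, IsConj (cs.simple i) (cs.simple j) → u i = u j)
    (F : Finset cs.Refl) :
    cs.regRep u hu (cs.eProd u F) = cs.opE k (cs.fgClosure F) := by
  classical
  induction F using Finset.induction_on with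
  | empty => rw [eProd_empty, map_one, fgClosure_empty, opE_bot]
  | insert t F _ ih => rw [eProd_insert, map_mul, ih, regRep_e, opE_mul, fgClosure_insert]

theorem regRep_toCAlg (hrep : ∀ H, cs.fgClosure (rep H) = H)
    (hu : ∀ i j : B, IsConj (cs.simple i) (cs.simple j) → u i = u j)
    (x : cs.FGReflectionSubgroup × W →₀ k) :
    cs.regRep u hu (cs.toCAlg u rep x) (Finsupp.single (⊥, 1) 1) = x := by
  have h : LinearMap.applyₗ (Finsupp.single (⊥, 1) 1) ∘ₗ (cs.regRep u hu).toLinearMap ∘ₗ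
      cs.toCAlg u rep = LinearMap.id := end_ext fun H w => by
    obtain ⟨ω, hω, rfl⟩ := cs.exists_isReduced w
    rw [LinearMap.comp_apply, LinearMap.comp_apply, toCAlg_single, AlgHom.toLinearMap_apply,
      map_mul, LinearMap.applyₗ_apply_apply, Module.End.mul_apply, ← hω.gWord_eq, regRep_gWord,
      prod_map_opG_single_bot_one cs u hω, regRep_eProd, opE_single, hrep, sup_bot_eq,
      LinearMap.id_apply]
  exact LinearMap.congr_fun h x

/-- The linear equivalence identifying `(H, w)` with `e_H g_w`. -/
noncomputable def equivCAlg (hrep : ∀ H, cs.fgClosure (rep H) = H)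
    (hu : ∀ i j : B, IsConj (cs.simple i) (cs.simple j) → u i = u j) :
    cs.CAlg u ≃ₗ[k] (cs.FGReflectionSubgroup × W →₀ k) :=
  LinearEquiv.ofLinearMap
    (LinearMap.applyₗ (Finsupp.single (⊥, 1) 1) ∘ₗ (cs.regRep u hu).toLinearMap)
    (cs.toCAlg u rep)
    (LinearMap.ext fun x => cs.regRep_toCAlg u hrep hu x)
    (LinearMap.ext fun c => by
      -- The intertwining property at `(⊥, 1)`, whose image is `1`, returns `c`.
      have h := cs.toCAlg_regRep u hrep hu c (Finsupp.single (⊥, 1) 1)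
      have h1 : cs.eProd u (rep ⊥) = 1 := by
        rw [← cs.eProd_empty u]
        apply cs.eProd_eq_of_fgClosure_eq
        rw [hrep, fgClosure_empty]
      rw [toCAlg_single, h1, gElt_one, mul_one, mul_one] at h
      exact h)

end Basis

end CoxeterSystem

theorem mainTheorem1 {B : Type*} {W : Type*} [Group W] {M : CoxeterMatrix B}
    (cs : CoxeterSystem M W) {k : Type*} [CommRing k] (u : B → k)
    (hu : ∀ i j : B, IsConj (cs.simple i) (cs.simple j) → u i = u j) :
    Module.Free k (cs.CAlg u) ∧
    -- for every choice of finite generating sets of reflections, the `e_J g_w` form a basis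
    (∀ rep : cs.FGReflectionSubgroup → Finset cs.Refl,
      (∀ H, cs.reflClosure (rep H : Set cs.Refl) = H.1) →
      ∃ b : Module.Basis (cs.FGReflectionSubgroup × W) k (cs.CAlg u),
        ∀ (H : cs.FGReflectionSubgroup) (ω : List B), cs.IsReduced ω →
          b (H, cs.wordProd ω) = cs.eProd u (rep H) * cs.gWord u ω) ∧
    -- the rank for finite `W`
    (Finite W → Module.Finite k (cs.CAlg u) ∧
      (Nontrivial k → Module.finrank k (cs.CAlg u) =
        Nat.card W * Nat.card {H : Subgroup W // cs.IsReflectionSubgroup H})) := by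
  have key : ∀ rep : cs.FGReflectionSubgroup → Finset cs.Refl,
      (∀ H, cs.reflClosure (rep H : Set cs.Refl) = H.1) →
      ∃ b : Module.Basis (cs.FGReflectionSubgroup × W) k (cs.CAlg u),
        ∀ (H : cs.FGReflectionSubgroup) (ω : List B), cs.IsReduced ω →
          b (H, cs.wordProd ω) = cs.eProd u (rep H) * cs.gWord u ω := by
    intro rep hrep
    refine ⟨⟨cs.equivCAlg u (rep := rep) (fun H => Subtype.ext (hrep H)) hu⟩, fun H ω hω => ?_⟩
    rw [hω.gWord_eq]
    exact cs.toCAlg_single u rep H _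
  choose rep hrep using cs.exists_fgClosure_eq
  obtain ⟨b, -⟩ := key rep fun H => congrArg Subtype.val (hrep H)
  refine ⟨Module.Free.of_basis b, key, fun _ => ⟨Module.Finite.of_basis b, fun _ => ?_⟩⟩
  rw [Module.finrank_eq_nat_card_basis b, Nat.card_prod, mul_comm]
  congr 1
  -- In a finite group every subgroup is finitely generated, so the index set is that of all
  -- reflection subgroups.
  refine Nat.card_congr (Equiv.subtypeEquivRight fun H => and_iff_left ?_)
  exact (Group.fg_iff_subgroup_fg H).1 inferInstance
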